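/- Let $U_0,U_1$ be unitary matrices of the same finite size $d\ge 1$, let $\Lambda_j(X)=U_jXU_j^\dagger$, and let $N\ge 1$. For $k\in\{0,\dots,N\}$ let $\mathcal E_k$ be the process made of $N$ successive channels, the $n$-th of which ($1\le n\le N$) is $\Lambda_1$ if $k<n$ and $\Lambda_0$ if $k\ge n$. A discrimination strategy (tester) prepares a state of the input system and a finite-dimensional ancilla, inserts the $N$ channels one after another with arbitrary quantum channels acting on system and ancilla in between, and finally performs a measurement with outcomes $0,\dots,N$ and "unknown"; it is unambiguous if outcome $m\in\{0,\dots,N\}$ has probability $0$ on $\mathcal E_k$ whenever $m\ne k$. Let $P^{(N)}$ be the maximum over unambiguous testers of $\frac1{N+1}\sum_{k=0}^N p_k$, where $p_k$ is the probability of outcome $k$ on $\mathcal E_k$. In the same sense consider unambiguous discrimination of $\Lambda_0$ and $\Lambda_1$, used once. Let $\overline p$ be the maximum probability with which $\Lambda_0$ can be correctly identified, and for $p\in[0,\overline p]$ let $f(p)$ be the maximum probability of correctly identifying $\Lambda_1$ when $\Lambda_0$ is correctly identified with probability $p$. Let $\overline P^{(N)}$ be the maximum of $\frac1{N+1}\sum_{i=0}^N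 p_i$ subject to $p_N\in[0,\overline p]$ and $p_{i-1}\in[0,f(p_i)]$ for $i=1,\dots,N$. Then all these maxima are attained, $f(0)\le\overline p$, and $$P^{(N)}=\overline P^{(N)}=1-t\cdot\frac{(N+2)c+Nc^{-1}}{2(N+1)},$$ where $t=\min_{\varphi}|\langle\varphi|U_0^\dagger U_1|\varphi\rangle|$ over unit vectors $\varphi$ (the minimum is attained), $c=1$ if $N$ is odd, and $c=\max\{t,\sqrt{N/(N+2)}\}$ if $N$ is even. Moreover, let $c_i=c$ for even $i$ and $c_i=c^{-1}$ for odd $i$, and let $\varphi$ be a unit vector and $u$ a complex number with $|u|=1$ and $\langle\varphi|U_0^\dagger U_1|\varphi\rangle=tu$. Then there is an unambiguous tester with a pure input state, unitary intermediate channels and an ancilla of fixed dimension that attains $P^{(N)}$, identifies $\mathcal E_k$ correctly with probability $1-tc_k$ for every $k$, and whose state vectors $|\psi_0\rangle,\dots,|\psi_N\rangle$ before the measurement, for the change points $0,\dots,N$, have the Gram matrix $$\bigl(\langle\psi_i|\psi_j\rangle\bigr)_{i,j=0}^N=\sum_{i=0}^N(1-tc_i)|i\rangle\langle i|+t|\mu\rangle\langle\mu|,\qquad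 |\mu\rangle=\sum_{i=0}^N u^i\sqrt{c_i}\,|i\rangle .$$ -/

import Mathlib

open scoped ComplexOrder Kronecker

namespace ChangePoint

/-! ### States, channels, measurements -/

/-- `Φ ⊗ id_a`, the map `Φ` applied to the first tensor factor (`Φ` acts on every block of `X`). -/
def ampliation {m n : Type*} (a : Type*) (Φ : Matrix m m ℂ →ₗ[ℂ] Matrix n n ℂ)
    (X : Matrix (m × a) (m × a) ℂ) : Matrix (n × a) (n × a) ℂ :=
  Matrix.of fun p q => Φ (Matrix.of fun i j => X (i, p.2) (j, q.2)) p.1 q.1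

/-- A quantum state (density matrix). -/
structure DensityMatrix (m : Type*) [Fintype m] where
  mat : Matrix m m ℂ
  posSemidef : mat.PosSemidef
  trace_eq_one : mat.trace = 1

/-- A quantum channel: a completely positive trace-preserving linear map. -/
structure Channel (m n : Type*) [Fintype m] [Fintype n] where
  map : Matrix m m ℂ →ₗ[ℂ] Matrix n n ℂ
  completelyPositive : ∀ (k : ℕ) (X : Matrix (m × Fin k) (m × Fin k) ℂ),
    X.PosSemidef → (ampliation (Fin k) map X).PosSemidef
  tracePreserving : ∀ X : Matrix m m ℂ, (map X).trace = X.trace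

/-- A quantum measurement (POVM) with outcomes in `κ`. -/
structure POVM (κ m : Type*) [Fintype κ] [Fintype m] [DecidableEq m] where
  elem : κ → Matrix m m ℂ
  posSemidef : ∀ x, (elem x).PosSemidef
  sum_eq_one : ∑ x, elem x = 1

theorem conj_ampliation {m a : Type*} [Fintype m] [Fintype a] [DecidableEq a]
    (U : Matrix m m ℂ) (Φ : Matrix m m ℂ →ₗ[ℂ] Matrix m m ℂ) (hΦ : ∀ X, Φ X = U * X * U.conjTranspose)
    (X : Matrix (m × a) (m × a) ℂ) :
    ampliation a Φ X = (U ⊗ₖ (1 : Matrix a a ℂ)) * X * (U ⊗ₖ (1 : Matrix a a ℂ)).conjTranspose := by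
  ext ⟨i, x⟩ ⟨j, y⟩
  simp [ampliation, hΦ, Matrix.mul_apply, Fintype.sum_prod_type, Matrix.one_apply,
    Matrix.kroneckerMap_apply, Matrix.conjTranspose_apply, apply_ite]

/-- The unitary channel `X ↦ U X U†`. -/
def unitaryChannel {m : Type*} [Fintype m] [DecidableEq m] (U : Matrix.unitaryGroup m ℂ) :
    Channel m m where
  map :=
    { toFun := fun X => (U : Matrix m m ℂ) * X * (U : Matrix m m ℂ).conjTranspose
      map_add' := fun X Y => by rw [mul_add, add_mul]
      map_smul' := fun z X => by simp }
  completelyPositive := fun k X hX => by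
    rw [conj_ampliation (U : Matrix m m ℂ) _ (fun _ => rfl)]
    exact hX.mul_mul_conjTranspose_same _
  tracePreserving := fun X => by
    have h : (U : Matrix m m ℂ).conjTranspose * (U : Matrix m m ℂ) = 1 :=
      Matrix.UnitaryGroup.star_mul_self U
    change ((U : Matrix m m ℂ) * X * (U : Matrix m m ℂ).conjTranspose).trace = X.trace
    rw [Matrix.trace_mul_comm, ← mul_assoc, h, one_mul]

/-- The pure state `|ξ⟩⟨ξ|` of a normalized vector `ξ`. -/
def pureState {m : Type*} [Fintype m] (ξ : m → ℂ) (hξ : star ξ ⬝ᵥ ξ = 1) : DensityMatrix m where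
  mat := Matrix.vecMulVec ξ (star ξ)
  posSemidef := Matrix.posSemidef_vecMulVec_self_star ξ
  trace_eq_one := by rw [Matrix.trace_vecMulVec, dotProduct_comm, hξ]

/-! ### Testers -/

/-- A general (adaptive, entanglement-assisted) discrimination strategy for processes that consist of
`N ≥ 1` channels from a system `V` to a system `W`, with outcomes in `κ`.
The `(n+1)`-st channel of the process is used while an ancilla of dimension `anc n` is kept;
`interm n` is the channel that is applied between uses `n+1` and `n+2` of the process
(only `n + 1 < N` matters), and `meas` is the final measurement. -/
structure Tester (V W : Type*) [Fintype V] [Fintype W] [DecidableEq W]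
    (N : ℕ) (κ : Type*) [Fintype κ] where
  anc : ℕ → ℕ
  init : DensityMatrix (V × Fin (anc 0))
  interm : ∀ n : ℕ, Channel (W × Fin (anc n)) (V × Fin (anc (n + 1)))
  meas : POVM κ (W × Fin (anc (N - 1)))

namespace Tester

variable {V W : Type*} [Fintype V] [Fintype W] [DecidableEq W] {N : ℕ}

/-- State of `W ⊗ ancilla` just after the `(n+1)`-st channel of the process `E` has been applied.
A process is the sequence `E 1, E 2, …, E N` of its channels. -/
def stateAfter {κ : Type*} [Fintype κ] (T : Tester V W N κ) (E : ℕ → Channel V W) :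
    (n : ℕ) → Matrix (W × Fin (T.anc n)) (W × Fin (T.anc n)) ℂ
  | 0 => ampliation _ (E 1).map T.init.mat
  | n + 1 => ampliation _ (E (n + 2)).map ((T.interm n).map (stateAfter T E n))

/-- Probability of the outcome `x` when the tester is applied to the process `E`. -/
def prob {κ : Type*} [Fintype κ] (T : Tester V W N κ) (E : ℕ → Channel V W) (x : κ) : ℝ :=
  (T.meas.elem x * T.stateAfter E (N - 1)).trace.re

variable {K : Type*} [Fintype K]

/-- The answer `some j` is "the process is `E j`", the answer `none` is "I don't know".
The strategy is unambiguous if it never returns a wrong conclusive answer. -/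
def IsUnambiguous (T : Tester V W N (Option K)) (E : K → ℕ → Channel V W) : Prop :=
  ∀ k j, j ≠ k → T.prob (E k) (some j) = 0

/-- Probability of correctly identifying `E k`. -/
def success (T : Tester V W N (Option K)) (E : K → ℕ → Channel V W) (k : K) : ℝ :=
  T.prob (E k) (some k)

end Tester

/-! ### The change point problem -/

section Problem

variable {V W : Type*} [Fintype V] [Fintype W] [DecidableEq W]

/-- The process with change point `k`: its `n`-th channel, `n = 1, …, N`, is `Λ₁` if `k < n`
and `Λ₀` otherwise. -/
def changeProcess (Λ₀ Λ₁ : Channel V W) (N : ℕ) (k : Fin (N + 1)) (n : ℕ) : Channel V W :=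
  if (k : ℕ) < n then Λ₁ else Λ₀

/-- Average success probability, for equally likely change points `0, …, N`. -/
noncomputable def averageSuccess (Λ₀ Λ₁ : Channel V W) (N : ℕ)
    (T : Tester V W N (Option (Fin (N + 1)))) : ℝ :=
  (∑ k, T.success (changeProcess Λ₀ Λ₁ N) k) / (N + 1)

/-- All average success probabilities of unambiguous strategies for the change point problem. -/
def achievableValues (Λ₀ Λ₁ : Channel V W) (N : ℕ) : Set ℝ :=
  {P | ∃ T : Tester V W N (Option (Fin (N + 1))),
    T.IsUnambiguous (changeProcess Λ₀ Λ₁ N) ∧ averageSuccess Λ₀ Λ₁ N T = P}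

/-- `P^(N)`: the maximum average success probability. -/
noncomputable def optimalSuccess (Λ₀ Λ₁ : Channel V W) (N : ℕ) : ℝ :=
  sSup (achievableValues Λ₀ Λ₁ N)

/-! ### The upper bound from discriminating the two channels -/

/-- The pairs `(p, q)` such that some unambiguous strategy using the channel once identifies
`Λ₀` correctly with probability `p` and `Λ₁` correctly with probability `q`. -/
def pairRegion (Λ₀ Λ₁ : Channel V W) : Set (ℝ × ℝ) :=
  {r | ∃ T : Tester V W 1 (Option (Fin 2)),
    T.IsUnambiguous (fun j _ => ![Λ₀, Λ₁] j) ∧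
    T.success (fun j _ => ![Λ₀, Λ₁] j) 0 = r.1 ∧ T.success (fun j _ => ![Λ₀, Λ₁] j) 1 = r.2}

/-- The probabilities with which `Λ₀` can be correctly identified. -/
def identifiable₀ (Λ₀ Λ₁ : Channel V W) : Set ℝ :=
  {p | ∃ q, (p, q) ∈ pairRegion Λ₀ Λ₁}

/-- The probabilities with which `Λ₁` can be correctly identified when `Λ₀` is correctly
identified with probability `p`. -/
def identifiable₁ (Λ₀ Λ₁ : Channel V W) (p : ℝ) : Set ℝ :=
  {q | (p, q) ∈ pairRegion Λ₀ Λ₁}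

/-- `p̄`: the maximum allowable value of `p`. -/
noncomputable def pbar (Λ₀ Λ₁ : Channel V W) : ℝ := sSup (identifiable₀ Λ₀ Λ₁)

/-- `f p`: the maximum probability of correctly identifying `Λ₁` when `Λ₀` is correctly identified
with probability `p`. -/
noncomputable def tradeoff (Λ₀ Λ₁ : Channel V W) (p : ℝ) : ℝ := sSup (identifiable₁ Λ₀ Λ₁ p)

/-- Values of the problem: maximize `∑ p_i / (N+1)` subject to `p_N ∈ [0, p̄]` and
`p_{i-1} ∈ [0, f(p_i)]` for `i = 1, …, N`. -/
def boundValues (Λ₀ Λ₁ : Channel V W) (N : ℕ) : Set ℝ :=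
  {P | ∃ p : Fin (N + 1) → ℝ,
    p (Fin.last N) ∈ Set.Icc 0 (pbar Λ₀ Λ₁) ∧
    (∀ i : Fin N, p i.castSucc ∈ Set.Icc 0 (tradeoff Λ₀ Λ₁ (p i.succ))) ∧
    (∑ i, p i) / (N + 1) = P}

/-- `Ū^(N)`: the optimal value of that problem. -/
noncomputable def upperBound (Λ₀ Λ₁ : Channel V W) (N : ℕ) : ℝ :=
  sSup (boundValues Λ₀ Λ₁ N)

end Problem

/-! ### Unitary channels -/

section Unitary

variable {ι : Type*} [Fintype ι] [DecidableEq ι]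

/-- `⟨φ|U₀†U₁|φ⟩`. -/
noncomputable def overlap (U₀ U₁ : Matrix.unitaryGroup ι ℂ) (φ : ι → ℂ) : ℂ :=
  star φ ⬝ᵥ (((U₀ : Matrix ι ι ℂ).conjTranspose * (U₁ : Matrix ι ι ℂ)).mulVec φ)

/-- The values `|⟨φ|U₀†U₁|φ⟩|` over all normalized vectors `φ`. -/
def overlapValues (U₀ U₁ : Matrix.unitaryGroup ι ℂ) : Set ℝ :=
  {r | ∃ φ : ι → ℂ, star φ ⬝ᵥ φ = 1 ∧ ‖overlap U₀ U₁ φ‖ = r}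

/-- `t = min_φ |⟨φ|U₀†U₁|φ⟩|`. -/
noncomputable def minOverlap (U₀ U₁ : Matrix.unitaryGroup ι ℂ) : ℝ :=
  sInf (overlapValues U₀ U₁)

/-- `c = 1` for odd `N` and `c = max {t, √(N/(N+2))}` for even `N`. -/
noncomputable def cParam (t : ℝ) (N : ℕ) : ℝ :=
  if Odd N then 1 else max t (Real.sqrt ((N : ℝ) / (N + 2)))

/-- `c_i = c` for even `i` and `c_i = c⁻¹` for odd `i`. -/
noncomputable def cSeq (c : ℝ) (i : ℕ) : ℝ := if Even i then c else c⁻¹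

/-- A sequential strategy with a pure input state and unitary intermediate operations, with an
ancilla of dimension `a`, before the choice of a measurement. -/
structure UnitaryStrategy (ι : Type*) [Fintype ι] [DecidableEq ι] (a : ℕ) where
  vec : ι × Fin a → ℂ
  normalized : star vec ⬝ᵥ vec = 1
  gate : ℕ → Matrix.unitaryGroup (ι × Fin a) ℂ

namespace UnitaryStrategy

variable {a : ℕ}

/-- The tester given by a unitary strategy and a final measurement. -/
def toTester (S : UnitaryStrategy ι a) (N : ℕ) {κ : Type*} [Fintype κ]
    (M : POVM κ (ι × Fin a)) : Tester ι ι N κ where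
  anc := fun _ => a
  init := pureState S.vec S.normalized
  interm := fun n => unitaryChannel (S.gate n)
  meas := M

/-- `|ψ_k^{(n+1)}⟩`: the state vector just after the `(n+1)`-st channel,
when the change point is `k`. -/
noncomputable def psi (S : UnitaryStrategy ι a) (U₀ U₁ : Matrix.unitaryGroup ι ℂ) (k : ℕ) :
    ℕ → (ι × Fin a → ℂ)
  | 0 => (((if k < 1 then U₁ else U₀ : Matrix.unitaryGroup ι ℂ) : Matrix ι ι ℂ) ⊗ₖ
      (1 : Matrix (Fin a) (Fin a) ℂ)).mulVec S.vec
  | n + 1 => (((if k < n + 2 then U₁ else U₀ : Matrix.unitaryGroup ι ℂ) : Matrix ι ι ℂ) ⊗ₖ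
      (1 : Matrix (Fin a) (Fin a) ℂ)).mulVec
        ((S.gate n : Matrix (ι × Fin a) (ι × Fin a) ℂ).mulVec (psi S U₀ U₁ k n))

/-- The Gram matrix `G_{ij} = ⟨ψ_i^{(N)}|ψ_j^{(N)}⟩` of the states before the measurement. -/
noncomputable def gram (S : UnitaryStrategy ι a) (U₀ U₁ : Matrix.unitaryGroup ι ℂ) (N : ℕ) :
    Matrix (Fin (N + 1)) (Fin (N + 1)) ℂ :=
  Matrix.of fun i j => star (S.psi U₀ U₁ i (N - 1)) ⬝ᵥ S.psi U₀ U₁ j (N - 1)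

end UnitaryStrategy

/-- `|μ⟩ = ∑_i u^i √c_i |i⟩`. -/
noncomputable def muVec (N : ℕ) (c : ℝ) (u : ℂ) (i : Fin (N + 1)) : ℂ :=
  u ^ (i : ℕ) * (Real.sqrt (cSeq c i) : ℂ)

/-- The matrix `∑_i (1 - t c_i) |i⟩⟨i| + t |μ⟩⟨μ|`. -/
noncomputable def targetGram (N : ℕ) (t c : ℝ) (u : ℂ) :
    Matrix (Fin (N + 1)) (Fin (N + 1)) ℂ :=
  Matrix.diagonal (fun i : Fin (N + 1) => ((1 - t * cSeq c i : ℝ) : ℂ)) +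
    (t : ℂ) • Matrix.vecMulVec (muVec N c u) (star (muVec N c u))

end Unitary

end ChangePoint

namespace ChangePoint

/-! ### Positive semidefinite matrices and traces -/

/-! Upper bound. The processes with change points `i` and `i + 1` differ only in channel number `i +
1`, so every tester for the chain contains a one-shot test of `Λ₀` against `Λ₁`. Pull the final
measurement back through the common later evolution. By Cauchy–Schwarz, the effects of the two
conclusive outcomes vanish on the cross term `V₁ ρ V₀†`. The remaining effect therefore carries its
whole trace, and Cauchy–Schwarz bounds the squared modulus of that trace by the product of the two
failure probabilities (`Tester.minOverlap_sq_le`). The trace is the value of `U₀†U₁` at a mixed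
state. The numerical range of a unitary matrix is convex, so some unit vector gives the same value
and its modulus is at least `t`. Hence `x_i = 1 - p_i` satisfies `t² ≤ x_i x_{i+1}`.

Both maxima thus reduce to one problem: minimize `∑ x_i` over `x_i ∈ [0, 1]` with `t² ≤ x_i
x_{i+1}`. For the chained bound this holds because `p̄ = 1 - t²` and `f p = 1 - t² / (1 - p)`. The
minimum is at the alternating point `x_i = t c_i`; a weighted sum of arithmetic–geometric mean
inequalities proves it (`mul_sum_cSeq_le_sum`).

Attainment. States with Gram matrix `G` can be identified unambiguously with probabilities `p` as
soon as `G - diag p` is positive semidefinite; for the target Gram matrix this difference is `t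
|μ⟩⟨μ|`. Since `c_i c_{i+1} = 1`, all its neighbouring entries equal `t u`, the overlap that one use
of the channel produces on `φ`. A gate can therefore rotate each neighbouring pair of target vectors
into the position where the next channel either keeps a vector or advances it to its successor
(`exists_unitaryStrategy_gram_eq`). -/

theorem exists_eq_conjTranspose_mul_self {m : Type*} [Fintype m] {A : Matrix m m ℂ}
    (hA : A.PosSemidef) : ∃ R : Matrix m m ℂ, A = R.conjTranspose * R := by
  classical
  open scoped MatrixOrder Matrix.Norms.L2Operator in
  exact CStarAlgebra.nonneg_iff_eq_star_mul_self.mp hA.nonneg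

theorem trace_mul_nonneg {m : Type*} [Fintype m] {A X : Matrix m m ℂ}
    (hA : A.PosSemidef) (hX : X.PosSemidef) : 0 ≤ (A * X).trace := by
  obtain ⟨R, rfl⟩ := exists_eq_conjTranspose_mul_self hA
  rw [mul_assoc, Matrix.trace_mul_comm]
  exact (hX.mul_mul_conjTranspose_same R).trace_nonneg

/-- Cauchy–Schwarz inequality for the Hilbert–Schmidt inner product. -/
theorem norm_trace_mul_conjTranspose_sq_le {m n : Type*} [Fintype m] [Fintype n]
    (P Q : Matrix m n ℂ) :
    ‖(P * Q.conjTranspose).trace‖ ^ 2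
      ≤ (P * P.conjTranspose).trace.re * (Q * Q.conjTranspose).trace.re := by
  have key : ∀ P Q : Matrix m n ℂ, (P * Q.conjTranspose).trace
      = inner ℂ (WithLp.toLp 2 fun x : m × n => Q x.1 x.2)
        (WithLp.toLp 2 fun x : m × n => P x.1 x.2) := by
    intro P Q
    simp [Matrix.trace, Matrix.mul_apply, PiLp.inner_apply, Fintype.sum_prod_type]
  have h := norm_inner_le_norm (𝕜 := ℂ) (WithLp.toLp 2 fun x : m × n => Q x.1 x.2)
    (WithLp.toLp 2 fun x : m × n => P x.1 x.2)
  rw [key P Q, key P P, key Q Q, inner_self_eq_norm_sq_to_K, inner_self_eq_norm_sq_to_K]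
  refine (pow_le_pow_left₀ (norm_nonneg _) h 2).trans (le_of_eq ?_)
  simp only [Complex.coe_algebraMap, ← Complex.ofReal_pow, Complex.ofReal_re]
  ring

/-- Cauchy–Schwarz inequality for the form `(X, Y) ↦ tr (A X ρ Y†)`. -/
theorem norm_trace_sandwich_sq_le {m : Type*} [Fintype m] {A ρ : Matrix m m ℂ}
    (hA : A.PosSemidef) (hρ : ρ.PosSemidef) (X Y : Matrix m m ℂ) :
    ‖(A * (X * ρ * Y.conjTranspose)).trace‖ ^ 2
      ≤ (A * (X * ρ * X.conjTranspose)).trace.re * (A * (Y * ρ * Y.conjTranspose)).trace.re := by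
  obtain ⟨R, rfl⟩ := exists_eq_conjTranspose_mul_self hA
  obtain ⟨S, rfl⟩ := exists_eq_conjTranspose_mul_self hρ
  have key : ∀ X Y : Matrix m m ℂ,
      (R.conjTranspose * R * (X * (S.conjTranspose * S) * Y.conjTranspose)).trace
      = ((R * X * S.conjTranspose) * (R * Y * S.conjTranspose).conjTranspose).trace := by
    intro X Y
    rw [mul_assoc, Matrix.trace_mul_comm]
    simp only [Matrix.conjTranspose_mul, Matrix.conjTranspose_conjTranspose, mul_assoc]
  rw [key, key, key]
  exact norm_trace_mul_conjTranspose_sq_le _ _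

/-- A positive functional on matrices is `X ↦ tr (A X)` with `A` positive semidefinite. -/
theorem exists_trace_mul_of_positive {m : Type*} [Fintype m] [DecidableEq m]
    (f : Matrix m m ℂ →ₗ[ℂ] ℂ) :
    ∃ A : Matrix m m ℂ, (∀ X, f X = (A * X).trace) ∧
      ((∀ X, X.PosSemidef → 0 ≤ f X) → A.PosSemidef) := by
  -- The indices are swapped because `tr (A E_ji) = A_ij`.
  refine ⟨Matrix.of fun i j => f (Matrix.single j i 1), ?_, ?_⟩
  · intro X
    conv_lhs => rw [Matrix.matrix_eq_sum_single X]
    have : ∀ i j, Matrix.single i j (X i j) = X i j • Matrix.single i j (1 : ℂ) := by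
      intro i j; simp
    simp only [map_sum, this, map_smul, Matrix.trace, Matrix.diag, Matrix.mul_apply, Matrix.of_apply,
      smul_eq_mul]
    rw [Finset.sum_comm]
    exact Finset.sum_congr rfl fun i _ => Finset.sum_congr rfl fun j _ => mul_comm _ _
  · intro hf
    have hq : ∀ x : m → ℂ, star x ⬝ᵥ (Matrix.of fun i j => f (Matrix.single j i 1)).mulVec x
        = f (Matrix.vecMulVec x (star x)) := by
      intro x
      conv_rhs => rw [Matrix.matrix_eq_sum_single (Matrix.vecMulVec x (star x))]
      have : ∀ i j, Matrix.single i j (Matrix.vecMulVec x (star x) i j)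
          = (x i * star (x j)) • Matrix.single i j (1 : ℂ) := by
        intro i j; simp [Matrix.vecMulVec_apply]
      simp only [map_sum, this, map_smul, dotProduct, Matrix.mulVec, Matrix.of_apply, Finset.mul_sum,
        smul_eq_mul, Pi.star_apply]
      rw [Finset.sum_comm]
      exact Finset.sum_congr rfl fun i _ => Finset.sum_congr rfl fun j _ => by ring
    have hpos : ∀ x : m → ℂ,
        0 ≤ star x ⬝ᵥ (Matrix.of fun i j => f (Matrix.single j i 1)).mulVec x := by
      intro x
      rw [hq]
      exact hf _ (Matrix.posSemidef_vecMulVec_self_star x)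
    rw [← Matrix.isPositive_toEuclideanLin_iff, LinearMap.isPositive_iff_complex]
    intro x
    have h := Complex.nonneg_iff.mp (hpos x.ofLp)
    rw [← inner_conj_symm, EuclideanSpace.inner_eq_star_dotProduct, dotProduct_comm,
      Matrix.ofLp_toLpLin, Matrix.toLin'_apply]
    refine ⟨Complex.ext rfl ?_, ?_⟩
    · rw [Complex.conj_im, ← h.2, Complex.ofReal_im, neg_zero]
    · exact h.1

/-! ### Diagonalization of unitary matrices -/

/-- A unitary matrix is unitarily diagonalizable. -/
theorem exists_unitary_mul_eq_mul_diagonal {n : Type*} [Fintype n] [DecidableEq n]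
    (U : Matrix.unitaryGroup n ℂ) :
    ∃ (Q : Matrix.unitaryGroup n ℂ) (d : n → ℂ),
      (U : Matrix n n ℂ) * (Q : Matrix n n ℂ) = (Q : Matrix n n ℂ) * Matrix.diagonal d := by
  -- The Cayley transform reduces the claim to the spectral theorem for Hermitian matrices. It needs
  -- a point `ω` of the unit circle outside the spectrum, which exists because the circle is
  -- infinite and the spectrum finite.
  obtain ⟨ω, hω, hωU⟩ : ∃ ω : ℂ, ω * star ω = 1 ∧
      IsUnit (algebraMap ℂ (Matrix n n ℂ) ω - (U : Matrix n n ℂ)) := by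
    have hinf : {ω : ℂ | ω * star ω = 1}.Infinite := by
      have hne : ∀ s : ℝ, (s : ℂ) + Complex.I ≠ 0 := fun s h0 => by
        simpa using congrArg Complex.im h0
      have hne' : ∀ s : ℝ, (s : ℂ) - Complex.I ≠ 0 := fun s h0 => by
        simpa using congrArg Complex.im h0
      refine Set.infinite_of_injective_forall_mem
        (f := fun s : ℝ => ((s : ℂ) + Complex.I) / ((s : ℂ) - Complex.I)) ?_ ?_
      · intro s r h
        have h1 := (div_eq_div_iff (hne' s) (hne' r)).mp h
        have h2 : Complex.I * (s : ℂ) = Complex.I * r := by linear_combination (-1 / 2 : ℂ) * h1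
        exact_mod_cast mul_left_cancel₀ Complex.I_ne_zero h2
      · intro s
        have hs : star (((s : ℂ) + Complex.I) / ((s : ℂ) - Complex.I))
            = ((s : ℂ) - Complex.I) / ((s : ℂ) + Complex.I) := by
          simp [sub_eq_add_neg]
        change _ * star _ = (1 : ℂ)
        rw [hs, div_mul_div_cancel₀ (hne' s), div_self (hne s)]
    obtain ⟨ω, hω, hωU⟩ := hinf.exists_notMem_finite (Matrix.finite_spectrum (U : Matrix n n ℂ))
    exact ⟨ω, hω, spectrum.notMem_iff.mp hωU⟩
  set A : Matrix n n ℂ := algebraMap ℂ (Matrix n n ℂ) ω - (U : Matrix n n ℂ) with hA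
  set B : Matrix n n ℂ := algebraMap ℂ (Matrix n n ℂ) ω + (U : Matrix n n ℂ) with hB
  have hU1 : star (U : Matrix n n ℂ) * (U : Matrix n n ℂ) = 1 := Matrix.UnitaryGroup.star_mul_self U
  obtain ⟨A', hAA', hA'A⟩ := isUnit_iff_exists.mp hωU
  have hst : star (algebraMap ℂ (Matrix n n ℂ) ω) = algebraMap ℂ (Matrix n n ℂ) (star ω) :=
    (algebraMap_star_comm ω).symm
  have h1 : algebraMap ℂ (Matrix n n ℂ) (star ω) * algebraMap ℂ (Matrix n n ℂ) ω = 1 := by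
    rw [← map_mul, mul_comm, hω, map_one]
  have hAB : star A * B = - (star B * A) := by
    rw [hA, hB, star_sub, star_add, hst]
    have := Algebra.commutes (star ω) (U : Matrix n n ℂ)
    simp only [sub_mul, add_mul, mul_sub, mul_add, h1, hU1]
    abel
  have hcomm : Commute B A := by
    have h := Algebra.commutes ω (U : Matrix n n ℂ)
    simp only [Commute, SemiconjBy, hA, hB, sub_mul, add_mul, mul_sub, mul_add, h]
    abel
  have hBA' : B * A' = A' * B := by
    calc B * A' = A' * A * (B * A') := by rw [hA'A, one_mul]
      _ = A' * (A * B) * A' := by simp only [mul_assoc]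
      _ = A' * (B * A) * A' := by rw [hcomm.eq]
      _ = A' * B * (A * A') := by simp only [mul_assoc]
      _ = A' * B := by rw [hAA', mul_one]
  have hA'st : star A' * star A = 1 := by rw [← star_mul, hAA', star_one]
  -- `i (ω + U)(ω - U)⁻¹` is the Cayley transform of `U`.
  have hH : (Complex.I • (B * A')).IsHermitian := by
    have : star (B * A') = - (B * A') := by
      calc star (B * A') = star A' * star B * (A * A') := by rw [star_mul, hAA', mul_one]
        _ = star A' * (star B * A) * A' := by simp only [mul_assoc]
        _ = - (star A' * star A * (B * A')) := by
          rw [← neg_eq_iff_eq_neg.mpr hAB]; simp only [mul_assoc, mul_neg, neg_mul]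
        _ = _ := by rw [hA'st, one_mul]
    rw [Matrix.IsHermitian, ← Matrix.star_eq_conjTranspose, star_smul, this]
    simp
  -- Solving `e = i (ω + λ) / (ω - λ)` for the eigenvalue `λ` of `U`; the denominator `e + i` is
  -- nonzero since `e` is real.
  refine ⟨hH.eigenvectorUnitary,
    fun j => ω * ((hH.eigenvalues j : ℂ) - Complex.I) / ((hH.eigenvalues j : ℂ) + Complex.I), ?_⟩
  set Q : Matrix n n ℂ := (hH.eigenvectorUnitary : Matrix n n ℂ)
  have hHQ : (Complex.I • (B * A')) * Q
      = Q * Matrix.diagonal (fun j => (hH.eigenvalues j : ℂ)) := by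
    have h := hH.spectral_theorem
    rw [Unitary.conjStarAlgAut_apply] at h
    conv_lhs => rw [h]
    rw [mul_assoc, Unitary.coe_star_mul_self, mul_one]
    rfl
  have hBQ : Complex.I • (B * Q) = A * Q * Matrix.diagonal (fun j => (hH.eigenvalues j : ℂ)) := by
    rw [mul_assoc, ← hHQ, hBA', Matrix.smul_mul, Matrix.mul_smul, ← mul_assoc, ← mul_assoc, hAA',
      one_mul]
  generalize hH.eigenvalues = e at *
  ext i j
  have h := congrFun (congrFun hBQ i) j
  simp only [hA, hB, Matrix.smul_apply, Matrix.mul_diagonal, add_mul, sub_mul, Matrix.add_apply,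
    Matrix.sub_apply, Algebra.algebraMap_eq_smul_one, Matrix.smul_mul, one_mul, smul_eq_mul] at h
  have hne : (e j : ℂ) + Complex.I ≠ 0 := by
    intro h0
    simpa using congrArg Complex.im h0
  rw [Matrix.mul_diagonal]
  field_simp
  linear_combination h

/-! ### The minimal overlap -/

/-- The partial trace over the second tensor factor. -/
def partialTrace {ι a : Type*} [Fintype a] (ρ : Matrix (ι × a) (ι × a) ℂ) : Matrix ι ι ℂ :=
  ∑ x, ρ.submatrix (fun i => (i, x)) fun i => (i, x)

theorem trace_kronecker_one_mul {ι a : Type*} [Fintype ι] [Fintype a] [DecidableEq a]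
    (A : Matrix ι ι ℂ) (ρ : Matrix (ι × a) (ι × a) ℂ) :
    ((A ⊗ₖ (1 : Matrix a a ℂ)) * ρ).trace = (A * partialTrace ρ).trace := by
  simp only [Matrix.trace, Matrix.diag, Matrix.mul_apply, partialTrace, Matrix.sum_apply,
    Matrix.submatrix_apply, Fintype.sum_prod_type, Matrix.kroneckerMap_apply, Matrix.one_apply,
    mul_ite, mul_one, mul_zero, ite_mul, zero_mul, Finset.sum_ite_eq, Finset.mem_univ, if_true,
    Finset.mul_sum]
  exact Finset.sum_congr rfl fun i _ => Finset.sum_comm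

section Overlap

variable {ι : Type*} [Fintype ι] [DecidableEq ι]

theorem star_dotProduct_self_eq_sum {m : Type*} [Fintype m] (φ : m → ℂ) :
    star φ ⬝ᵥ φ = ((∑ i, ‖φ i‖ ^ 2 : ℝ) : ℂ) := by
  simp [dotProduct, Complex.conj_mul']

theorem isLeast_overlapValues [Nonempty ι] (U₀ U₁ : Matrix.unitaryGroup ι ℂ) :
    IsLeast (overlapValues U₀ U₁) (minOverlap U₀ U₁) := by
  have himg : overlapValues U₀ U₁
      = (fun φ => ‖overlap U₀ U₁ φ‖) '' {φ : ι → ℂ | star φ ⬝ᵥ φ = 1} := rfl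
  have hclosed : IsClosed {φ : ι → ℂ | star φ ⬝ᵥ φ = 1} :=
    isClosed_eq (by fun_prop) continuous_const
  have hbdd : Bornology.IsBounded {φ : ι → ℂ | star φ ⬝ᵥ φ = 1} := by
    refine (Metric.isBounded_closedBall (x := (0 : ι → ℂ)) (r := 1)).subset fun φ hφ => ?_
    rw [Metric.mem_closedBall, dist_zero_right, pi_norm_le_iff_of_nonneg zero_le_one]
    intro i
    have h : ∑ i, ‖φ i‖ ^ 2 = 1 := by
      have h1 : star φ ⬝ᵥ φ = 1 := hφ
      rw [star_dotProduct_self_eq_sum] at h1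
      exact_mod_cast h1
    have := Finset.single_le_sum (f := fun i => ‖φ i‖ ^ 2) (fun i _ => sq_nonneg _)
      (Finset.mem_univ i)
    nlinarith [norm_nonneg (φ i)]
  have hcont : Continuous (fun φ => ‖overlap U₀ U₁ φ‖) := by
    unfold overlap; fun_prop
  have hcomp : IsCompact (overlapValues U₀ U₁) := by
    rw [himg]
    exact (Metric.isCompact_of_isClosed_isBounded hclosed hbdd).image hcont
  have hne : (overlapValues U₀ U₁).Nonempty := by
    obtain ⟨i⟩ := ‹Nonempty ι›
    exact ⟨_, Pi.single i 1, by simp, rfl⟩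
  exact hcomp.isLeast_sInf hne

theorem minOverlap_nonneg [Nonempty ι] (U₀ U₁ : Matrix.unitaryGroup ι ℂ) :
    0 ≤ minOverlap U₀ U₁ := by
  obtain ⟨φ, -, h⟩ := (isLeast_overlapValues U₀ U₁).1
  exact h ▸ norm_nonneg _

theorem star_mulVec_dotProduct_mulVec {m n : Type*} [Fintype m] [Fintype n] (A : Matrix m n ℂ)
    (v w : n → ℂ) : star (A.mulVec v) ⬝ᵥ A.mulVec w
      = star v ⬝ᵥ ((A.conjTranspose * A).mulVec w) := by
  rw [Matrix.star_mulVec, ← Matrix.dotProduct_mulVec, Matrix.mulVec_mulVec]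

theorem star_unitary_mulVec_dotProduct {m : Type*} [Fintype m] [DecidableEq m]
    (U : Matrix.unitaryGroup m ℂ) (v w : m → ℂ) :
    star ((U : Matrix m m ℂ).mulVec v) ⬝ᵥ (U : Matrix m m ℂ).mulVec w = star v ⬝ᵥ w := by
  rw [star_mulVec_dotProduct_mulVec, ← Matrix.star_eq_conjTranspose,
    Matrix.UnitaryGroup.star_mul_self, Matrix.one_mulVec]

/-- The numerical range of a unitary matrix contains its values at mixed states. -/
theorem exists_unit_vector_eq_trace (U : Matrix.unitaryGroup ι ℂ) (σ : DensityMatrix ι) :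
    ∃ φ : ι → ℂ, star φ ⬝ᵥ φ = 1 ∧
      star φ ⬝ᵥ (U : Matrix ι ι ℂ).mulVec φ = ((U : Matrix ι ι ℂ) * σ.mat).trace := by
  obtain ⟨Q, d, hQ⟩ := exists_unitary_mul_eq_mul_diagonal U
  have hQ1 : star (Q : Matrix ι ι ℂ) * (Q : Matrix ι ι ℂ) = 1 := Matrix.UnitaryGroup.star_mul_self Q
  have hQ2 : (Q : Matrix ι ι ℂ) * star (Q : Matrix ι ι ℂ) = 1 := Unitary.coe_mul_star_self Q
  set τ : Matrix ι ι ℂ := (Q : Matrix ι ι ℂ).conjTranspose * σ.mat * (Q : Matrix ι ι ℂ) with hτ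
  have hτpos : τ.PosSemidef := σ.posSemidef.conjTranspose_mul_mul_same _
  have hτtr : τ.trace = 1 := by
    rw [hτ, Matrix.trace_mul_comm, ← mul_assoc, ← Matrix.star_eq_conjTranspose, hQ2, one_mul,
      σ.trace_eq_one]
  -- In an eigenbasis of `U` the trace sees only the diagonal of the state, a probability vector.
  -- Its entrywise square root is a pure state with the same diagonal.
  set r : ι → ℂ := fun i => ((Real.sqrt (τ i i).re : ℝ) : ℂ) with hr
  have hrr : ∀ i, star (r i) * r i = τ i i := by
    intro i
    have h := Complex.nonneg_iff.mp (hτpos.diag_nonneg (i := i))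
    rw [hr, RCLike.star_def, Complex.conj_ofReal, ← Complex.ofReal_mul, Real.mul_self_sqrt h.1]
    exact Complex.ext rfl h.2
  refine ⟨(Q : Matrix ι ι ℂ).mulVec r, ?_, ?_⟩
  · rw [star_unitary_mulVec_dotProduct, ← hτtr]
    exact Finset.sum_congr rfl fun i _ => hrr i
  · rw [Matrix.mulVec_mulVec, hQ, ← Matrix.mulVec_mulVec, star_unitary_mulVec_dotProduct]
    have hU : (U : Matrix ι ι ℂ) = (Q : Matrix ι ι ℂ) * Matrix.diagonal d * star (Q : Matrix ι ι ℂ) := by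
      rw [← hQ, mul_assoc, hQ2, mul_one]
    have htr : ((U : Matrix ι ι ℂ) * σ.mat).trace = (Matrix.diagonal d * τ).trace := by
      rw [hU, mul_assoc, mul_assoc, Matrix.trace_mul_comm, hτ, Matrix.star_eq_conjTranspose]
      simp only [mul_assoc]
    rw [htr]
    simp only [dotProduct, Matrix.mulVec_diagonal, Matrix.trace, Matrix.diag, Matrix.diagonal_mul,
      Pi.star_apply, ← hrr]
    exact Finset.sum_congr rfl fun i _ => by ring

/-- The minimal overlap bounds the overlap of all mixed states with an ancilla. -/
theorem minOverlap_le_norm_trace [Nonempty ι] (U₀ U₁ : Matrix.unitaryGroup ι ℂ)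
    {a : Type*} [Fintype a] [DecidableEq a] {ρ : Matrix (ι × a) (ι × a) ℂ} (hρ : ρ.PosSemidef)
    (htr : ρ.trace = 1) :
    minOverlap U₀ U₁ ≤ ‖(((U₁ : Matrix ι ι ℂ) ⊗ₖ (1 : Matrix a a ℂ)) * ρ *
      ((U₀ : Matrix ι ι ℂ) ⊗ₖ (1 : Matrix a a ℂ)).conjTranspose).trace‖ := by
  have hσ : (partialTrace ρ).PosSemidef := Matrix.posSemidef_sum _ fun x _ => hρ.submatrix _
  have hσtr : (partialTrace ρ).trace = 1 := by
    have h := trace_kronecker_one_mul (1 : Matrix ι ι ℂ) ρ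
    rw [Matrix.one_kronecker_one, one_mul, one_mul, htr] at h
    exact h.symm
  obtain ⟨φ, hφ, h⟩ := exists_unit_vector_eq_trace (star U₀ * U₁) ⟨_, hσ, hσtr⟩
  refine (isLeast_overlapValues U₀ U₁).2 ⟨φ, hφ, ?_⟩
  rw [Matrix.trace_mul_comm, ← mul_assoc, Matrix.conjTranspose_kronecker, Matrix.conjTranspose_one,
    ← Matrix.mul_kronecker_mul, one_mul, trace_kronecker_one_mul]
  exact congrArg norm h

end Overlap

/-! ### Unambiguous discrimination of processes that differ in one channel -/

/-- Complete positivity with a one-dimensional ancilla. -/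
theorem Channel.map_posSemidef {m n : Type*} [Fintype m] [Fintype n] (Φ : Channel m n)
    {X : Matrix m m ℂ} (hX : X.PosSemidef) : (Φ.map X).PosSemidef :=
  (Φ.completelyPositive 1 (X.submatrix Prod.fst Prod.fst) (hX.submatrix _)).submatrix
    fun i => (i, (0 : Fin 1))

/-- `ampliation` as a linear map. -/
def ampliationLinear {m n : Type*} (a : Type*) (Φ : Matrix m m ℂ →ₗ[ℂ] Matrix n n ℂ) :
    Matrix (m × a) (m × a) ℂ →ₗ[ℂ] Matrix (n × a) (n × a) ℂ where
  toFun := ampliation a Φ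
  map_add' X Y := by
    ext p q
    exact congrFun (congrFun (Φ.map_add (Matrix.of fun i j => X (i, p.2) (j, q.2))
      (Matrix.of fun i j => Y (i, p.2) (j, q.2))) p.1) q.1
  map_smul' z X := by
    ext p q
    exact congrFun (congrFun (Φ.map_smul z (Matrix.of fun i j => X (i, p.2) (j, q.2))) p.1) q.1

theorem Channel.trace_ampliation {m n a : Type*} [Fintype m] [Fintype n] [Fintype a]
    (Φ : Channel m n) (X : Matrix (m × a) (m × a) ℂ) :
    (ampliation a Φ.map X).trace = X.trace := by
  simp only [Matrix.trace, Matrix.diag, Fintype.sum_prod_type_right]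
  exact Finset.sum_congr rfl fun x _ => Φ.tracePreserving (Matrix.of fun i j => X (i, x) (j, x))

namespace Tester

variable {V W κ : Type*} [Fintype V] [Fintype W] [DecidableEq W] [Fintype κ] {N : ℕ}
  (T : Tester V W N κ)

theorem stateAfter_posSemidef_and_trace (E : ℕ → Channel V W) (n : ℕ) :
    (T.stateAfter E n).PosSemidef ∧ (T.stateAfter E n).trace = 1 := by
  induction n with
  | zero =>
    exact ⟨(E 1).completelyPositive _ _ T.init.posSemidef,
      ((E 1).trace_ampliation _).trans T.init.trace_eq_one⟩
  | succ n ih =>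
    exact ⟨(E (n + 2)).completelyPositive _ _ ((T.interm n).map_posSemidef ih.1),
      ((E (n + 2)).trace_ampliation _).trans (((T.interm n).tracePreserving _).trans ih.2)⟩

theorem stateAfter_congr {E E' : ℕ → Channel V W} (n : ℕ)
    (h : ∀ i ≤ n, E (i + 1) = E' (i + 1)) : T.stateAfter E n = T.stateAfter E' n := by
  induction n with
  | zero => simp only [stateAfter, h 0 le_rfl]
  | succ n ih =>
    simp only [stateAfter, ih fun i hi => h i (hi.trans n.le_succ), h (n + 1) le_rfl]

/-- Processes that agree in the first `s` channels are applied to the same state. -/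
theorem exists_common_input {E E' : ℕ → Channel V W} (s : ℕ)
    (h : ∀ i < s, E (i + 1) = E' (i + 1)) :
    ∃ ρ : Matrix (V × Fin (T.anc s)) (V × Fin (T.anc s)) ℂ, ρ.PosSemidef ∧ ρ.trace = 1 ∧
      T.stateAfter E s = ampliation _ (E (s + 1)).map ρ ∧
      T.stateAfter E' s = ampliation _ (E' (s + 1)).map ρ := by
  cases s with
  | zero => exact ⟨_, T.init.posSemidef, T.init.trace_eq_one, rfl, rfl⟩
  | succ s =>
    refine ⟨(T.interm s).map (T.stateAfter E s),
      (T.interm s).map_posSemidef (T.stateAfter_posSemidef_and_trace E s).1,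
      ((T.interm s).tracePreserving _).trans (T.stateAfter_posSemidef_and_trace E s).2, rfl, ?_⟩
    rw [T.stateAfter_congr s fun i hi => h i (Nat.lt_succ_of_le hi)]
    rfl

/-- Processes that agree after the channel number `s + 1` induce the same evolution afterwards. -/
theorem exists_common_evolution {E E' : ℕ → Channel V W} (s k : ℕ)
    (h : ∀ i, s < i → i ≤ s + k → E (i + 1) = E' (i + 1)) :
    ∃ Φ : Matrix (W × Fin (T.anc s)) (W × Fin (T.anc s)) ℂ →ₗ[ℂ]
        Matrix (W × Fin (T.anc (s + k))) (W × Fin (T.anc (s + k))) ℂ,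
      (∀ X, X.PosSemidef → (Φ X).PosSemidef) ∧ (∀ X, (Φ X).trace = X.trace) ∧
      T.stateAfter E (s + k) = Φ (T.stateAfter E s) ∧
      T.stateAfter E' (s + k) = Φ (T.stateAfter E' s) := by
  induction k with
  | zero => exact ⟨LinearMap.id, fun _ hX => hX, fun _ => rfl, rfl, rfl⟩
  | succ k ih =>
    obtain ⟨Φ, hpos, htr, h1, h2⟩ := ih fun i hi hi' => h i hi (hi'.trans (Nat.le_succ _))
    refine ⟨(ampliationLinear _ (E (s + k + 2)).map).comp ((T.interm (s + k)).map.comp Φ),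
      fun X hX => (E (s + k + 2)).completelyPositive _ _
        ((T.interm (s + k)).map_posSemidef (hpos X hX)),
      fun X => ((E (s + k + 2)).trace_ampliation _).trans
        (((T.interm (s + k)).tracePreserving _).trans (htr X)), ?_, ?_⟩
    · change ampliation _ (E (s + k + 2)).map ((T.interm (s + k)).map (T.stateAfter E (s + k))) = _
      rw [h1]
      rfl
    · change ampliation _ (E' (s + k + 2)).map ((T.interm (s + k)).map (T.stateAfter E' (s + k))) = _
      rw [h2, ← h (s + k + 1) (by omega) (by omega)]
      rfl

theorem prob_nonneg (E : ℕ → Channel V W) (x : κ) : 0 ≤ T.prob E x :=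
  (Complex.nonneg_iff.mp (trace_mul_nonneg (T.meas.posSemidef x)
    (T.stateAfter_posSemidef_and_trace E (N - 1)).1)).1

theorem sum_prob (E : ℕ → Channel V W) : ∑ x, T.prob E x = 1 := by
  simp only [prob]
  rw [← Complex.re_sum, ← Matrix.trace_sum, ← Finset.sum_mul, T.meas.sum_eq_one, one_mul,
    (T.stateAfter_posSemidef_and_trace E (N - 1)).2, Complex.one_re]

theorem prob_le_one (E : ℕ → Channel V W) (x : κ) : T.prob E x ≤ 1 := by
  rw [← T.sum_prob E]
  exact Finset.single_le_sum (fun y _ => T.prob_nonneg E y) (Finset.mem_univ x)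

end Tester

variable {ι : Type*} [Fintype ι] [DecidableEq ι]

theorem ampliation_unitaryChannel {a : Type*} [Fintype a] [DecidableEq a]
    (U : Matrix.unitaryGroup ι ℂ) (X : Matrix (ι × a) (ι × a) ℂ) :
    ampliation a (unitaryChannel U).map X = ((U : Matrix ι ι ℂ) ⊗ₖ (1 : Matrix a a ℂ)) * X *
      ((U : Matrix ι ι ℂ) ⊗ₖ (1 : Matrix a a ℂ)).conjTranspose :=
  conj_ampliation _ _ (fun _ => rfl) X

theorem eq_zero_of_sq_norm_le_zero {z : ℂ} (h : ‖z‖ ^ 2 ≤ 0) : z = 0 := by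
  have : ‖z‖ = 0 := by nlinarith [norm_nonneg z]
  exact norm_eq_zero.mp this

/-- Two unambiguous conclusive outcomes for processes that differ in a single channel, which is
`U₀` in one and `U₁` in the other, satisfy the trade-off relation given by the minimal overlap. -/
theorem Tester.minOverlap_sq_le [Nonempty ι] {κ : Type*} [Fintype κ] {N : ℕ}
    (T : Tester ι ι N κ) (U₀ U₁ : Matrix.unitaryGroup ι ℂ) {E E' : ℕ → Channel ι ι} {s : ℕ}
    (hs : s < N) (hE : E (s + 1) = unitaryChannel U₀) (hE' : E' (s + 1) = unitaryChannel U₁)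
    (h : ∀ i < N, i ≠ s → E (i + 1) = E' (i + 1)) {x y : κ} (hxy : x ≠ y)
    (hx : T.prob E' x = 0) (hy : T.prob E y = 0) :
    minOverlap U₀ U₁ ^ 2 ≤ (1 - T.prob E x) * (1 - T.prob E' y) := by
  classical
  obtain ⟨k, hk⟩ : ∃ k, N - 1 = s + k := ⟨N - 1 - s, by omega⟩
  obtain ⟨ρ, hρ, hρtr, h1, h2⟩ := T.exists_common_input (E := E) (E' := E') s
    fun i hi => h i (hi.trans hs) hi.ne
  obtain ⟨Φ, hΦ, hΦtr, h3, h4⟩ := T.exists_common_evolution (E := E) (E' := E') s k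
    fun i hi hi' => h i (by omega) hi.ne'
  -- The type of the measurement depends on `N - 1`; repackaging its data lets that index be
  -- rewritten to `s + k`.
  obtain ⟨M, hM, hMsum, hprob⟩ : ∃ M : κ → Matrix (ι × Fin (T.anc (s + k))) _ ℂ,
      (∀ z, (M z).PosSemidef) ∧ ∑ z, M z = 1 ∧
      ∀ E z, T.prob E z = (M z * T.stateAfter E (s + k)).trace.re := by
    rw [← hk]
    exact ⟨T.meas.elem, T.meas.posSemidef, T.meas.sum_eq_one, fun _ _ => rfl⟩
  -- Heisenberg picture: the effects are pulled back to the moment just after the channel in which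
  -- the processes differ.
  have hA : ∀ z, ∃ A : Matrix (ι × Fin (T.anc s)) (ι × Fin (T.anc s)) ℂ, A.PosSemidef ∧
      ∀ X, (M z * Φ X).trace = (A * X).trace := by
    intro z
    obtain ⟨A, hA1, hA2⟩ := exists_trace_mul_of_positive
      ((Matrix.traceLinearMap _ ℂ ℂ).comp ((LinearMap.mulLeft ℂ (M z)).comp Φ))
    exact ⟨A, hA2 fun X hX => trace_mul_nonneg (hM z) (hΦ X hX), hA1⟩
  choose A hApos hA using hA
  set V₀ := (U₀ : Matrix ι ι ℂ) ⊗ₖ (1 : Matrix (Fin (T.anc s)) (Fin (T.anc s)) ℂ) with hV₀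
  set V₁ := (U₁ : Matrix ι ι ℂ) ⊗ₖ (1 : Matrix (Fin (T.anc s)) (Fin (T.anc s)) ℂ) with hV₁
  have hpE : ∀ z, T.prob E z = (A z * (V₀ * ρ * V₀.conjTranspose)).trace.re := by
    intro z
    rw [hprob, h3, h1, hE, ampliation_unitaryChannel, hA]
  have hpE' : ∀ z, T.prob E' z = (A z * (V₁ * ρ * V₁.conjTranspose)).trace.re := by
    intro z
    rw [hprob, h4, h2, hE', ampliation_unitaryChannel, hA]
  -- Each conclusive outcome has probability zero on one of the two processes, so one factor in
  -- Cauchy–Schwarz vanishes.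
  have hzx : (A x * (V₁ * ρ * V₀.conjTranspose)).trace = 0 := by
    apply eq_zero_of_sq_norm_le_zero
    have := norm_trace_sandwich_sq_le (hApos x) hρ V₁ V₀
    rwa [← hpE', hx, zero_mul] at this
  have hzy : (A y * (V₁ * ρ * V₀.conjTranspose)).trace = 0 := by
    apply eq_zero_of_sq_norm_le_zero
    have := norm_trace_sandwich_sq_le (hApos y) hρ V₁ V₀
    rwa [← hpE y, hy, mul_zero] at this
  -- All other outcomes are merged into a single inconclusive effect. Its probabilities on the two
  -- processes are the two failure probabilities.
  set B := ∑ z ∈ (Finset.univ.erase x).erase y, A z with hB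
  have hBpos : B.PosSemidef := Matrix.posSemidef_sum _ fun z _ => hApos z
  have hBtr : ∀ X, (B * X).trace = X.trace - (A x * X).trace - (A y * X).trace := by
    intro X
    have hsum : ∑ z, (A z * X).trace = X.trace := by
      simp only [← hA]
      rw [← Matrix.trace_sum, ← Finset.sum_mul, hMsum, one_mul, hΦtr]
    rw [← hsum, ← Finset.add_sum_erase _ _ (Finset.mem_univ x),
      ← Finset.add_sum_erase _ _ (Finset.mem_erase.mpr ⟨hxy.symm, Finset.mem_univ y⟩), hB,
      Finset.sum_mul, Matrix.trace_sum]
    ring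
  have htr : ∀ U : Matrix.unitaryGroup ι ℂ,
      (((U : Matrix ι ι ℂ) ⊗ₖ (1 : Matrix (Fin (T.anc s)) (Fin (T.anc s)) ℂ)) * ρ *
        ((U : Matrix ι ι ℂ) ⊗ₖ (1 : Matrix (Fin (T.anc s)) (Fin (T.anc s)) ℂ)).conjTranspose).trace
      = 1 := by
    intro U
    rw [← ampliation_unitaryChannel, Channel.trace_ampliation, hρtr]
  have hmain := norm_trace_sandwich_sq_le hBpos hρ V₁ V₀
  rw [hBtr, hBtr, hBtr, hzx, hzy, htr, htr, sub_zero, sub_zero] at hmain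
  simp only [Complex.sub_re, Complex.one_re, ← hpE, ← hpE', hx, hy, sub_zero] at hmain
  calc minOverlap U₀ U₁ ^ 2 ≤ ‖(V₁ * ρ * V₀.conjTranspose).trace‖ ^ 2 :=
        pow_le_pow_left₀ (minOverlap_nonneg U₀ U₁) (minOverlap_le_norm_trace U₀ U₁ hρ hρtr) 2
    _ ≤ _ := hmain.trans_eq (mul_comm _ _)

/-! ### Factorizations through contractions and unitaries -/

section Factorization

variable {F H G : Type*} [NormedAddCommGroup F] [InnerProductSpace ℂ F]
  [NormedAddCommGroup H] [InnerProductSpace ℂ H] [NormedAddCommGroup G] [InnerProductSpace ℂ G]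
  [FiniteDimensional ℂ H]

/-- **Douglas factorization**: a map dominated by `A` factors through `A` by a contraction. -/
theorem exists_contraction_comp_eq (A : F →ₗ[ℂ] H) (B : F →ₗ[ℂ] G) (h : ∀ x, ‖B x‖ ≤ ‖A x‖) :
    ∃ C : H →ₗ[ℂ] G, (∀ x, C (A x) = B x) ∧ ∀ y, ‖C y‖ ≤ ‖y‖ := by
  obtain ⟨s, hs⟩ := A.rangeRestrict.exists_rightInverse_of_surjective A.range_rangeRestrict
  have hs' : ∀ y : LinearMap.range A, A (s y) = y := fun y =>
    congrArg Subtype.val (LinearMap.congr_fun hs y)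
  refine ⟨(B.comp s).comp (LinearMap.range A).orthogonalProjectionOnto.toLinearMap, fun x => ?_,
    fun y => ?_⟩
  · have h1 : (LinearMap.range A).orthogonalProjectionOnto (A x) = A.rangeRestrict x :=
      Submodule.orthogonalProjectionOnto_mem_subspace_eq_self (A.rangeRestrict x)
    -- The chosen preimage differs from `x` by an element of the kernel of `A`, on which `B`
    -- vanishes by domination.
    have h2 : ‖B (s (A.rangeRestrict x) - x)‖ ≤ 0 := by
      refine (h _).trans ?_
      rw [map_sub, hs']
      simp
    have h3 := norm_le_zero_iff.mp h2
    rw [map_sub, sub_eq_zero] at h3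
    change B (s ((LinearMap.range A).orthogonalProjectionOnto (A x))) = B x
    rw [h1, h3]
  · refine (h _).trans ?_
    rw [hs']
    exact Submodule.norm_orthogonalProjectionOnto_apply_le _ y

/-- Maps with equal norms differ by an isometry of the codomain. -/
theorem exists_isometry_comp_eq (A B : F →ₗ[ℂ] H) (h : ∀ x, ‖B x‖ = ‖A x‖) :
    ∃ C : H →ₗᵢ[ℂ] H, ∀ x, C (A x) = B x := by
  obtain ⟨C, hC, -⟩ := exists_contraction_comp_eq A B fun x => (h x).le
  let L : LinearMap.range A →ₗᵢ[ℂ] H :=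
    { toLinearMap := C.comp (LinearMap.range A).subtype
      norm_map' := by
        rintro ⟨_, x, rfl⟩
        exact (congrArg norm (hC x)).trans (h x) }
  exact ⟨L.extend, fun x => (L.extend_apply ⟨A x, x, rfl⟩).trans (hC x)⟩

end Factorization

theorem norm_toEuclideanLin_sq {m k : Type*} [Fintype m] [Fintype k] [DecidableEq k]
    (A : Matrix m k ℂ) (x : EuclideanSpace ℂ k) :
    ((‖A.toEuclideanLin x‖ ^ 2 : ℝ) : ℂ)
      = star x.ofLp ⬝ᵥ (A.conjTranspose * A).mulVec x.ofLp := by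
  rw [← star_mulVec_dotProduct_mulVec, star_dotProduct_self_eq_sum, EuclideanSpace.norm_sq_eq]
  rfl

section Matrices

variable {m k l : Type*} [Fintype m] [DecidableEq m] [Fintype k] [DecidableEq k]
  [Fintype l]

theorem exists_contraction_mul_eq (A : Matrix m k ℂ) (B : Matrix l k ℂ)
    (h : (A.conjTranspose * A - B.conjTranspose * B).PosSemidef) :
    ∃ K : Matrix l m ℂ, K * A = B ∧ (1 - K.conjTranspose * K).PosSemidef := by
  obtain ⟨C, hC, hC1⟩ := exists_contraction_comp_eq A.toEuclideanLin B.toEuclideanLin fun x => by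
    have h1 := h.dotProduct_mulVec_nonneg x.ofLp
    rw [Matrix.sub_mulVec, dotProduct_sub, ← norm_toEuclideanLin_sq, ← norm_toEuclideanLin_sq,
      sub_nonneg, Complex.real_le_real] at h1
    exact le_of_sq_le_sq h1 (norm_nonneg _)
  obtain ⟨K, rfl⟩ := Matrix.toEuclideanLin.surjective C
  refine ⟨K, ?_, Matrix.PosSemidef.of_dotProduct_mulVec_nonneg ?_ fun x => ?_⟩
  · apply Matrix.toEuclideanLin.injective
    ext1 x
    rw [← hC]
    simp [Matrix.toLpLin_apply, Matrix.mulVec_mulVec]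
  · exact Matrix.isHermitian_one.sub (Matrix.isHermitian_conjTranspose_mul_self K)
  · have h1 := hC1 (WithLp.toLp 2 x)
    have h2 := norm_toEuclideanLin_sq K (WithLp.toLp 2 x)
    rw [Matrix.sub_mulVec, dotProduct_sub, ← h2, Matrix.one_mulVec, star_dotProduct_self_eq_sum,
      sub_nonneg, Complex.real_le_real]
    refine (pow_le_pow_left₀ (norm_nonneg _) h1 2).trans_eq ?_
    rw [EuclideanSpace.norm_sq_eq]

/-- The hypothesis says that the columns of `A` and of `B` have the same Gram matrix; the isometry
between their spans extends to the whole space. -/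
theorem exists_unitary_mul_eq (A B : Matrix m k ℂ)
    (h : A.conjTranspose * A = B.conjTranspose * B) :
    ∃ W : Matrix.unitaryGroup m ℂ, (W : Matrix m m ℂ) * A = B := by
  obtain ⟨C, hC⟩ := exists_isometry_comp_eq A.toEuclideanLin B.toEuclideanLin fun x => by
    have h1 := norm_toEuclideanLin_sq A x
    rw [h, ← norm_toEuclideanLin_sq, Complex.ofReal_inj] at h1
    exact ((sq_eq_sq₀ (norm_nonneg _) (norm_nonneg _)).mp h1).symm
  obtain ⟨W, hW⟩ := Matrix.toEuclideanLin.surjective C.toLinearMap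
  have hW' : ∀ x, Matrix.toEuclideanLin W x = C x := fun x => LinearMap.congr_fun hW x
  refine ⟨⟨W, Matrix.mem_unitaryGroup_iff'.mpr ?_⟩, ?_⟩
  · ext i j
    have h1 := C.inner_map_map (EuclideanSpace.single i 1) (EuclideanSpace.single j 1)
    rw [← hW', ← hW', EuclideanSpace.inner_eq_star_dotProduct, dotProduct_comm,
      EuclideanSpace.inner_single_left] at h1
    simp only [Matrix.toLpLin_apply, PiLp.ofLp_single, Matrix.mulVec_single_one, map_one, one_mul,
      Pi.single_apply] at h1
    rw [Matrix.one_apply]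
    exact h1
  · apply Matrix.toEuclideanLin.injective
    ext1 x
    rw [← hC, ← hW']
    simp [Matrix.toLpLin_apply, Matrix.mulVec_mulVec]

/-- States whose Gram matrix dominates `diag p` can be identified unambiguously with
probabilities `p`. -/
theorem exists_povm_of_gram_sub_diagonal_posSemidef (ψ : k → m → ℂ) (p : k → ℝ) (hp : ∀ j, 0 ≤ p j)
    (h : ((Matrix.of fun i j => star (ψ i) ⬝ᵥ ψ j) -
      Matrix.diagonal fun i => (p i : ℂ)).PosSemidef) :
    ∃ M : POVM (Option k) m, ∀ i j,
      star (ψ i) ⬝ᵥ (M.elem (some j)).mulVec (ψ i) = if i = j then (p j : ℂ) else 0 := by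
  set A : Matrix m k ℂ := Matrix.of fun x i => ψ i x with hA
  set B : Matrix k k ℂ := Matrix.diagonal fun i => ((Real.sqrt (p i) : ℝ) : ℂ) with hB
  have hAA : A.conjTranspose * A = Matrix.of fun i j => star (ψ i) ⬝ᵥ ψ j := by
    ext i j; rfl
  have hBB : B.conjTranspose * B = Matrix.diagonal fun i => (p i : ℂ) := by
    rw [hB, Matrix.diagonal_conjTranspose, Matrix.diagonal_mul_diagonal]
    congr 1
    ext i
    simp [← Complex.ofReal_mul, Real.mul_self_sqrt (hp i)]
  rw [← hAA, ← hBB] at h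
  -- `K` sends `ψ i` to `√(p i)` times the `i`-th basis vector. Measuring in that basis after `K`
  -- cannot err, and `1 - K†K` is the inconclusive effect.
  obtain ⟨K, hK, hK1⟩ := exists_contraction_mul_eq A B h
  refine ⟨⟨fun x => x.elim (1 - K.conjTranspose * K)
    fun j => Matrix.vecMulVec (star (K j)) (star (star (K j))), ?_, ?_⟩, fun i j => ?_⟩
  · rintro (_ | j)
    · exact hK1
    · exact Matrix.posSemidef_vecMulVec_self_star _
  · rw [Fintype.sum_option]
    simp only [Option.elim]
    rw [sub_add_eq_add_sub, sub_eq_iff_eq_add, add_right_inj]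
    ext x y
    simp [Matrix.sum_apply, Matrix.vecMulVec_apply, Matrix.mul_apply]
  · have h1 : K j ⬝ᵥ ψ i = B j i := by rw [← hK]; rfl
    have h2 : star (ψ i) ⬝ᵥ star (K j) = star (B j i) := by
      rw [← h1, Matrix.star_dotProduct_star]
    simp only [Option.elim, star_star, Matrix.vecMulVec_mulVec, dotProduct_smul, h1, h2]
    rw [hB, Matrix.diagonal_apply]
    by_cases hij : i = j
    · subst hij
      simp [← Complex.ofReal_mul, Real.mul_self_sqrt (hp i)]
    · simp [hij, Ne.symm hij]

end Matrices

/-! ### The chain optimization problem -/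

theorem cParam_le_one {t : ℝ} (ht : t ≤ 1) (N : ℕ) : cParam t N ≤ 1 := by
  unfold cParam
  split_ifs
  · exact le_rfl
  · refine max_le ht (Real.sqrt_le_one.mpr ?_)
    rw [div_le_one (by positivity)]
    linarith

theorem le_cParam {t : ℝ} (ht : t ≤ 1) (N : ℕ) : t ≤ cParam t N := by
  unfold cParam
  split_ifs
  · exact ht
  · exact le_max_left _ _

theorem cParam_pos (t : ℝ) {N : ℕ} (hN : 1 ≤ N) : 0 < cParam t N := by
  unfold cParam
  split_ifs
  · exact one_pos
  · have : (0 : ℝ) < N := by exact_mod_cast hN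
    exact lt_max_of_lt_right (Real.sqrt_pos.mpr (by positivity))

theorem cSeq_pos {c : ℝ} (hc : 0 < c) (i : ℕ) : 0 < cSeq c i := by
  unfold cSeq
  split_ifs
  · exact hc
  · exact inv_pos.mpr hc

/-- Consequently `x_i = t c_i` saturates every constraint `t² ≤ x_i x_{i+1}`. -/
theorem cSeq_mul_cSeq_succ {c : ℝ} (hc : 0 < c) (i : ℕ) : cSeq c i * cSeq c (i + 1) = 1 := by
  unfold cSeq
  by_cases h : Even i
  · rw [if_pos h, if_neg (by rwa [Nat.even_add_one, not_not]), mul_inv_cancel₀ hc.ne']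
  · rw [if_neg h, if_pos (by rwa [Nat.even_add_one]), inv_mul_cancel₀ hc.ne']

/-- This keeps the success probabilities `1 - t c_i` nonnegative. At odd indices it needs `t ≤ c`,
which explains the maximum with `t` in `cParam`. -/
theorem mul_cSeq_le_one {t c : ℝ} (ht : 0 ≤ t) (htc : t ≤ c) (hc : 0 < c) (hc1 : c ≤ 1) (i : ℕ) :
    t * cSeq c i ≤ 1 := by
  unfold cSeq
  split_ifs
  · nlinarith
  · rw [← div_eq_mul_inv, div_le_one hc]
    exact htc

/-- This keeps `1 - t c_i` below `p̄ = 1 - t²`. -/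
theorem sq_le_mul_cSeq {t c : ℝ} (ht : 0 ≤ t) (htc : t ≤ c) (hc : 0 < c) (hc1 : c ≤ 1) (i : ℕ) :
    t ^ 2 ≤ t * cSeq c i := by
  unfold cSeq
  split_ifs
  · nlinarith
  · have : 1 ≤ c⁻¹ := (one_le_inv₀ hc).mpr hc1
    nlinarith

theorem sum_range_two_mul (x : ℕ → ℝ) (m : ℕ) :
    ∑ i ∈ Finset.range (2 * m), x i
      = ∑ j ∈ Finset.range m, x (2 * j) + ∑ j ∈ Finset.range m, x (2 * j + 1) := by
  induction m with
  | zero => simp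
  | succ m ih =>
    rw [Nat.mul_succ, Finset.sum_range_succ, Finset.sum_range_succ, ih, Finset.sum_range_succ,
      Finset.sum_range_succ]
    ring

theorem sum_cSeq_cParam (t : ℝ) (N : ℕ) :
    ∑ i ∈ Finset.range (N + 1), cSeq (cParam t N) i
      = (((N : ℝ) + 2) * cParam t N + (N : ℝ) * (cParam t N)⁻¹) / 2 := by
  rcases Nat.even_or_odd' N with ⟨m, rfl | rfl⟩
  · rw [Finset.sum_range_succ, sum_range_two_mul]
    simp [cSeq]
    ring
  · have hc : cParam t (2 * m + 1) = 1 := by simp [cParam]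
    simp [hc, cSeq]
    ring

theorem two_mul_le_add_of_sq_le_mul {a b s : ℝ} (ha : 0 ≤ a) (hb : 0 ≤ b) (h : s ^ 2 ≤ a * b) :
    2 * s ≤ a + b :=
  le_of_sq_le_sq (by nlinarith [sq_nonneg (a - b)]) (by positivity)

/-- The weighted inequalities of all neighbours in a chain of even length `2 m` add up. -/
theorem sum_chain_pairs (x : ℕ → ℝ) (c m : ℝ) (k : ℕ) :
    ∑ j ∈ Finset.range k, ((m - j) * (x (2 * j) + c ^ 2 * x (2 * j + 1))
        + (j + 1) * (x (2 * j + 2) + c ^ 2 * x (2 * j + 1)))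
      = m * ∑ j ∈ Finset.range k, x (2 * j) + k * x (2 * k)
        + c ^ 2 * (m + 1) * ∑ j ∈ Finset.range k, x (2 * j + 1) := by
  induction k with
  | zero => simp
  | succ k ih =>
    rw [Finset.sum_range_succ, ih, Finset.sum_range_succ, Finset.sum_range_succ, Nat.mul_succ]
    push_cast
    ring

/-- The minimum of `∑ x_i` subject to `x_i ∈ [0, 1]` and `t² ≤ x_i x_{i+1}`. -/
theorem mul_sum_cSeq_le_sum {t : ℝ} {N : ℕ} (hN : 1 ≤ N) (x : ℕ → ℝ)
    (hx0 : ∀ i ≤ N, 0 ≤ x i) (hx1 : ∀ i ≤ N, x i ≤ 1)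
    (h : ∀ i < N, t ^ 2 ≤ x i * x (i + 1)) :
    t * ∑ i ∈ Finset.range (N + 1), cSeq (cParam t N) i ≤ ∑ i ∈ Finset.range (N + 1), x i := by
  rw [sum_cSeq_cParam]
  rcases Nat.even_or_odd' N with ⟨m, rfl | rfl⟩
  · set c := cParam t (2 * m) with hc
    have hcpos : 0 < c := cParam_pos t hN
    have hm : (0 : ℝ) < m := by
      have : 0 < m := by omega
      exact_mod_cast this
    have hc2 : c = max t (Real.sqrt ((m : ℝ) / (m + 1))) := by
      rw [hc, cParam, if_neg (by simp)]
      congr 2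
      push_cast
      rw [show (2 * (m : ℝ) + 2) = 2 * (m + 1) by ring, mul_div_mul_left _ _ two_ne_zero]
    have hsq : Real.sqrt ((m : ℝ) / (m + 1)) ^ 2 = m / (m + 1) := Real.sq_sqrt (by positivity)
    -- The weight `c²` makes the mean inequality sharp at the expected optimum `a = t c`, `b = t /
    -- c`, where `a = c² b`.
    have hpair : ∀ a b : ℝ, 0 ≤ a → 0 ≤ b → t ^ 2 ≤ a * b → 2 * (c * t) ≤ a + c ^ 2 * b := by
      intro a b ha hb hab
      refine two_mul_le_add_of_sq_le_mul ha (by positivity) ?_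
      nlinarith [mul_le_mul_of_nonneg_left hab (sq_nonneg c)]
    -- With edge weights `m - j` and `j + 1`, every even entry, both ends included, collects the
    -- weight `m`, and every odd entry collects `c² (m + 1)`.
    have hsum := sum_chain_pairs x c m m
    set O := ∑ j ∈ Finset.range m, x (2 * j + 1) with hO
    set S := ∑ j ∈ Finset.range m, x (2 * j) with hS
    have hlow : (m : ℝ) * ((m + 1) * (2 * (c * t)))
        ≤ m * S + m * x (2 * m) + c ^ 2 * (m + 1) * O := by
      rw [← hsum]
      have hcard : (m : ℝ) * ((m + 1) * (2 * (c * t)))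
          = ∑ j ∈ Finset.range m, ((m : ℝ) + 1) * (2 * (c * t)) := by simp
      rw [hcard]
      refine Finset.sum_le_sum fun j hj => ?_
      have hj' : j < m := Finset.mem_range.mp hj
      have hjm : (j : ℝ) ≤ m := by exact_mod_cast hj'.le
      have h1 := hpair _ _ (hx0 (2 * j) (by omega)) (hx0 (2 * j + 1) (by omega))
        (h (2 * j) (by omega))
      have h2 := hpair _ _ (hx0 (2 * j + 2) (by omega)) (hx0 (2 * j + 1) (by omega))
        ((h (2 * j + 1) (by omega)).trans_eq (mul_comm _ _))
      have h3 := mul_le_mul_of_nonneg_left h1 (sub_nonneg.mpr hjm)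
      have h4 := mul_le_mul_of_nonneg_left h2 (by positivity : (0 : ℝ) ≤ j + 1)
      linarith
    have hOm : O ≤ m := by
      have : O ≤ ∑ _j ∈ Finset.range m, (1 : ℝ) :=
        Finset.sum_le_sum fun j hj => hx1 _ (by have := Finset.mem_range.mp hj; omega)
      simpa using this
    rw [Finset.sum_range_succ, sum_range_two_mul, ← hO, ← hS]
    push_cast
    rw [show ((2 * (m : ℝ) + 2) * c + 2 * m * c⁻¹) / 2 = (m + 1) * c + m * c⁻¹ by ring]
    have hinv : c * c⁻¹ = 1 := mul_inv_cancel₀ hcpos.ne'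
    refine le_of_mul_le_mul_left ?_ hm
    -- If `c = t`, the odd entries carry the excess weight `c² (m + 1) - m ≥ 0`, which is paid for
    -- by `x_i ≤ 1`. Otherwise `c² (m + 1) = m`, all entries have the same weight, and the upper
    -- bound on `x_i` is not needed.
    rcases max_choice t (Real.sqrt ((m : ℝ) / (m + 1))) with hmax | hmax
    · have hct : c = t := hc2.trans hmax
      have hge : (m : ℝ) ≤ c ^ 2 * (m + 1) := by
        have : Real.sqrt ((m : ℝ) / (m + 1)) ≤ c := hc2 ▸ le_max_right _ _
        have h1 := pow_le_pow_left₀ (Real.sqrt_nonneg _) this 2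
        rwa [hsq, div_le_iff₀ (by positivity)] at h1
      have h5 := mul_le_mul_of_nonneg_left hOm (sub_nonneg.mpr hge)
      rw [← hct] at hlow ⊢
      have h6 : (m : ℝ) * (c * ((m + 1) * c + m * c⁻¹)) = m * ((m + 1) * c ^ 2 + m) := by
        linear_combination (m : ℝ) * m * hinv
      rw [h6]
      nlinarith
    · have hcs : c ^ 2 * (m + 1) = m := by
        rw [hc2, hmax, hsq]; field_simp
      rw [hcs] at hlow
      have h6 : (m : ℝ) * (t * ((m + 1) * c + m * c⁻¹)) = m * ((m + 1) * (2 * (c * t))) := by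
        have : (m : ℝ) * c⁻¹ = (m + 1) * c := by
          linear_combination (-c⁻¹) * hcs + (c * (m + 1)) * hinv
        rw [this]; ring
      rw [h6]
      linarith
  · have hc : cParam t (2 * m + 1) = 1 := by simp [cParam]
    -- For odd `N` the chain splits into disjoint neighbouring pairs, each contributing at least `2
    -- t`.
    rw [hc, show 2 * m + 1 + 1 = 2 * (m + 1) by ring, sum_range_two_mul, ← Finset.sum_add_distrib]
    have : ∑ _j ∈ Finset.range (m + 1), (2 * t) ≤
        ∑ j ∈ Finset.range (m + 1), (x (2 * j) + x (2 * j + 1)) := by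
      refine Finset.sum_le_sum fun j hj => ?_
      have hj' := Finset.mem_range.mp hj
      exact two_mul_le_add_of_sq_le_mul (hx0 _ (by omega)) (hx0 _ (by omega)) (h _ (by omega))
    rw [Finset.sum_const, Finset.card_range, nsmul_eq_mul] at this
    push_cast at this ⊢
    rw [inv_one]
    linarith

/-- `mul_sum_cSeq_le_sum` in terms of the success probabilities `1 - x_i`. -/
theorem average_le_of_sq_le {t : ℝ} {N : ℕ} (hN : 1 ≤ N)
    (p : Fin (N + 1) → ℝ) (hp0 : ∀ i, 0 ≤ p i) (hp1 : ∀ i, p i ≤ 1)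
    (h : ∀ i : Fin N, t ^ 2 ≤ (1 - p i.castSucc) * (1 - p i.succ)) :
    (∑ i, p i) / (N + 1) ≤ (∑ i : Fin (N + 1), (1 - t * cSeq (cParam t N) i)) / (N + 1) := by
  have key := mul_sum_cSeq_le_sum hN (fun i => 1 - p (Fin.ofNat (N + 1) i))
    (fun i _ => sub_nonneg.mpr (hp1 _)) (fun i _ => sub_le_self _ (hp0 _)) fun i hi => by
      have h1 := h ⟨i, hi⟩
      have e1 : Fin.ofNat (N + 1) i = (⟨i, hi⟩ : Fin N).castSucc :=
        Fin.ext (Nat.mod_eq_of_lt (by omega))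
      have e2 : Fin.ofNat (N + 1) (i + 1) = (⟨i, hi⟩ : Fin N).succ :=
        Fin.ext (Nat.mod_eq_of_lt (by omega))
      rwa [← e1, ← e2] at h1
  rw [← Fin.sum_univ_eq_sum_range, ← Fin.sum_univ_eq_sum_range] at key
  have e : ∀ i : Fin (N + 1), Fin.ofNat (N + 1) (i : ℕ) = i := fun i =>
    Fin.ext (Nat.mod_eq_of_lt i.isLt)
  simp only [e] at key
  refine div_le_div_of_nonneg_right ?_ (by positivity)
  rw [Finset.sum_sub_distrib] at key ⊢
  rw [← Finset.mul_sum]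
  linarith

theorem average_cSeq (t : ℝ) (N : ℕ) :
    (∑ i : Fin (N + 1), (1 - t * cSeq (cParam t N) i)) / ((N : ℝ) + 1)
      = 1 - t * ((((N : ℝ) + 2) * cParam t N + (N : ℝ) * (cParam t N)⁻¹) / (2 * ((N : ℝ) + 1))) := by
  have h := sum_cSeq_cParam t N
  rw [← Fin.sum_univ_eq_sum_range] at h
  rw [Finset.sum_sub_distrib, ← Finset.mul_sum, h]
  have : (N : ℝ) + 1 ≠ 0 := by positivity
  simp
  field_simp

/-! ### Unitary strategies -/

section Strategy

variable {ι : Type*} [Fintype ι] [DecidableEq ι] {a : ℕ}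

theorem mul_vecMulVec_mul_conjTranspose {m n : Type*} [Fintype m] (A : Matrix n m ℂ) (v : m → ℂ) :
    A * Matrix.vecMulVec v (star v) * A.conjTranspose
      = Matrix.vecMulVec (A.mulVec v) (star (A.mulVec v)) := by
  rw [Matrix.mul_vecMulVec, Matrix.vecMulVec_mul, Matrix.star_mulVec]

/-- `U ⊗ 1` as a unitary matrix. -/
def extendUnitary (a : ℕ) (U : Matrix.unitaryGroup ι ℂ) : Matrix.unitaryGroup (ι × Fin a) ℂ :=
  ⟨(U : Matrix ι ι ℂ) ⊗ₖ (1 : Matrix (Fin a) (Fin a) ℂ),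
    Matrix.kronecker_mem_unitary U.2 (one_mem _)⟩

theorem coe_unitary_mul_mulVec {m : Type*} [Fintype m] [DecidableEq m]
    (U V : Matrix.unitaryGroup m ℂ) (v : m → ℂ) :
    (U : Matrix m m ℂ).mulVec ((V : Matrix m m ℂ).mulVec v)
      = ((U * V : Matrix.unitaryGroup m ℂ) : Matrix m m ℂ).mulVec v :=
  Matrix.mulVec_mulVec _ _ _

theorem trace_mul_vecMulVec_star {m : Type*} [Fintype m] (A : Matrix m m ℂ) (v : m → ℂ) :
    (A * Matrix.vecMulVec v (star v)).trace = star v ⬝ᵥ A.mulVec v := by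
  rw [Matrix.mul_vecMulVec, Matrix.trace_vecMulVec, dotProduct_comm]

namespace UnitaryStrategy

theorem changeProcess_unitaryChannel (U₀ U₁ : Matrix.unitaryGroup ι ℂ) (N : ℕ) (k : Fin (N + 1))
    (n : ℕ) : changeProcess (unitaryChannel U₀) (unitaryChannel U₁) N k n
      = unitaryChannel (if (k : ℕ) < n then U₁ else U₀) := by
  unfold changeProcess
  split_ifs <;> rfl

theorem stateAfter_toTester (S : UnitaryStrategy ι a) {N : ℕ} {κ : Type*} [Fintype κ]
    (M : POVM κ (ι × Fin a)) (U₀ U₁ : Matrix.unitaryGroup ι ℂ) (k : Fin (N + 1)) (n : ℕ) :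
    (S.toTester N M).stateAfter (changeProcess (unitaryChannel U₀) (unitaryChannel U₁) N k) n
      = Matrix.vecMulVec (S.psi U₀ U₁ k n) (star (S.psi U₀ U₁ k n)) := by
  induction n with
  | zero =>
    rw [Tester.stateAfter, changeProcess_unitaryChannel]
    refine (ampliation_unitaryChannel _ _).trans ?_
    exact mul_vecMulVec_mul_conjTranspose _ _
  | succ n ih =>
    rw [Tester.stateAfter, changeProcess_unitaryChannel]
    refine (congrArg (fun X : Matrix (ι × Fin a) (ι × Fin a) ℂ => ampliation (Fin a)
      (unitaryChannel (if (k : ℕ) < n + 2 then U₁ else U₀)).map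
        ((unitaryChannel (S.gate n)).map X)) ih).trans ?_
    refine (ampliation_unitaryChannel _ _).trans ?_
    have h : (unitaryChannel (S.gate n)).map
        (Matrix.vecMulVec (S.psi U₀ U₁ k n) (star (S.psi U₀ U₁ k n))) = _ :=
      mul_vecMulVec_mul_conjTranspose _ _
    rw [h]
    exact mul_vecMulVec_mul_conjTranspose _ _

theorem prob_toTester (S : UnitaryStrategy ι a) {N : ℕ} {κ : Type*} [Fintype κ]
    (M : POVM κ (ι × Fin a)) (U₀ U₁ : Matrix.unitaryGroup ι ℂ) (k : Fin (N + 1)) (x : κ) :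
    (S.toTester N M).prob (changeProcess (unitaryChannel U₀) (unitaryChannel U₁) N k) x
      = (star (S.psi U₀ U₁ k (N - 1)) ⬝ᵥ (M.elem x).mulVec (S.psi U₀ U₁ k (N - 1))).re := by
  rw [Tester.prob, stateAfter_toTester]
  exact congrArg Complex.re (trace_mul_vecMulVec_star _ _)

end UnitaryStrategy

/-- Every pair of probabilities compatible with the trade-off relation is attained by a single use
of the channel. -/
theorem mem_pairRegion_of_sq_le (U₀ U₁ : Matrix.unitaryGroup ι ℂ) {φ : ι → ℂ}
    (hφ : star φ ⬝ᵥ φ = 1) {p q : ℝ} (hp0 : 0 ≤ p) (hp1 : p ≤ 1) (hq0 : 0 ≤ q) (hq1 : q ≤ 1)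
    (h : ‖overlap U₀ U₁ φ‖ ^ 2 ≤ (1 - p) * (1 - q)) :
    (p, q) ∈ pairRegion (unitaryChannel U₀) (unitaryChannel U₁) := by
  set v : ι × Fin 1 → ℂ := fun x => φ x.1 with hv
  have hvv : ∀ φ φ' : ι → ℂ, (star fun x : ι × Fin 1 => φ x.1) ⬝ᵥ (fun x : ι × Fin 1 => φ' x.1)
      = star φ ⬝ᵥ φ' := fun φ φ' => by simp [dotProduct, Fintype.sum_prod_type]
  have hmul : ∀ U : Matrix.unitaryGroup ι ℂ,
      ((U : Matrix ι ι ℂ) ⊗ₖ (1 : Matrix (Fin 1) (Fin 1) ℂ)).mulVec v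
        = fun x => (U : Matrix ι ι ℂ).mulVec φ x.1 := by
    intro U
    ext x
    simp [hv, Matrix.mulVec, dotProduct, Fintype.sum_prod_type, Matrix.kroneckerMap_apply,
      Matrix.one_apply, eq_iff_true_of_subsingleton]
  let U : Fin 2 → Matrix.unitaryGroup ι ℂ := ![U₀, U₁]
  let ψ : Fin 2 → ι × Fin 1 → ℂ := fun j x => (U j : Matrix ι ι ℂ).mulVec φ x.1
  have h00 : ∀ j, star (ψ j) ⬝ᵥ ψ j = 1 := fun j => by
    rw [hvv, star_unitary_mulVec_dotProduct, hφ]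
  have h01 : star (ψ 0) ⬝ᵥ ψ 1 = overlap U₀ U₁ φ := by
    rw [hvv, Matrix.star_mulVec, ← Matrix.dotProduct_mulVec, Matrix.mulVec_mulVec]
    rfl
  have h10 : star (ψ 1) ⬝ᵥ ψ 0 = star (overlap U₀ U₁ φ) := by
    rw [← h01, Matrix.star_dotProduct]
  -- The matrix has diagonal `1 - p`, `1 - q` and off-diagonal entries `z`, `z̄`; the hypothesis
  -- says that its determinant is nonnegative.
  have hps : ((Matrix.of fun i j => star (ψ i) ⬝ᵥ ψ j) -
      Matrix.diagonal fun i => ((![p, q] i : ℝ) : ℂ)).PosSemidef := by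
    set z := overlap U₀ U₁ φ
    have hG : (Matrix.of fun i j => star (ψ i) ⬝ᵥ ψ j) = !![1, z; star z, 1] := by
      ext i j
      fin_cases i <;> fin_cases j <;> simp [h00, h01, h10]
    rw [hG]
    refine Matrix.PosSemidef.of_dotProduct_mulVec_nonneg ?_ fun x => ?_
    · ext i j
      fin_cases i <;> fin_cases j <;> simp
    · have hq : star x ⬝ᵥ (!![1, z; star z, 1] -
          Matrix.diagonal fun i => ((![p, q] i : ℝ) : ℂ)).mulVec x
          = (((1 - p) * ‖x 0‖ ^ 2 + (1 - q) * ‖x 1‖ ^ 2 + 2 * (star (x 0) * z * x 1).re : ℝ) : ℂ) := by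
        have h1 : ((2 * (star (x 0) * z * x 1).re : ℝ) : ℂ)
            = star (x 0) * z * x 1 + star (star (x 0) * z * x 1) := (Complex.add_conj _).symm
        rw [Complex.ofReal_add, h1]
        push_cast
        rw [← Complex.conj_mul', ← Complex.conj_mul']
        simp [dotProduct, Matrix.mulVec, Fin.sum_univ_two]
        ring
      rw [hq, Complex.zero_le_real]
      have hre : -(‖x 0‖ * ‖z‖ * ‖x 1‖) ≤ (star (x 0) * z * x 1).re := by
        have h2 := (abs_le.mp (Complex.abs_re_le_norm (star (x 0) * z * x 1))).1
        rwa [norm_mul, norm_mul, norm_star] at h2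
      have h3 : 2 * (‖x 0‖ * ‖z‖ * ‖x 1‖) ≤ (1 - p) * ‖x 0‖ ^ 2 + (1 - q) * ‖x 1‖ ^ 2 := by
        refine two_mul_le_add_of_sq_le_mul (mul_nonneg (sub_nonneg.mpr hp1) (sq_nonneg _))
          (mul_nonneg (sub_nonneg.mpr hq1) (sq_nonneg _)) ?_
        have := mul_le_mul_of_nonneg_left h (by positivity : 0 ≤ ‖x 0‖ ^ 2 * ‖x 1‖ ^ 2)
        nlinarith
      linarith
  obtain ⟨M, hM⟩ := exists_povm_of_gram_sub_diagonal_posSemidef ψ ![p, q]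
    (by intro j; fin_cases j <;> simpa) hps
  let S : UnitaryStrategy ι 1 := ⟨v, (hvv φ φ).trans hφ, fun _ => 1⟩
  have hprob : ∀ k j : Fin 2, (S.toTester 1 M).prob
      (fun _ => ![unitaryChannel U₀, unitaryChannel U₁] k) (some j)
      = if k = j then ![p, q] j else 0 := by
    intro k j
    have h1 : (S.toTester 1 M).stateAfter (fun _ => ![unitaryChannel U₀, unitaryChannel U₁] k) 0
        = Matrix.vecMulVec (ψ k) (star (ψ k)) := by
      have h2 : ![unitaryChannel U₀, unitaryChannel U₁] k = unitaryChannel (U k) := by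
        fin_cases k <;> rfl
      rw [Tester.stateAfter, h2]
      refine (ampliation_unitaryChannel _ _).trans ?_
      refine (mul_vecMulVec_mul_conjTranspose _ _).trans ?_
      exact congrArg (fun w => Matrix.vecMulVec w (star w)) (hmul (U k))
    have h3 : (S.toTester 1 M).prob (fun _ => ![unitaryChannel U₀, unitaryChannel U₁] k) (some j)
        = (star (ψ k) ⬝ᵥ (M.elem (some j)).mulVec (ψ k)).re := by
      rw [← trace_mul_vecMulVec_star, ← h1]
      rfl
    rw [h3, hM]
    split_ifs <;> simp
  refine ⟨S.toTester 1 M, fun k j hjk => ?_, ?_, ?_⟩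
  · rw [hprob, if_neg hjk.symm]
  · exact (hprob 0 0).trans (by simp)
  · exact (hprob 1 1).trans (by simp)

theorem targetGram_sub_diagonal (N : ℕ) (t c : ℝ) (u : ℂ) :
    targetGram N t c u - Matrix.diagonal (fun i : Fin (N + 1) => ((1 - t * cSeq c i : ℝ) : ℂ))
      = (t : ℂ) • Matrix.vecMulVec (muVec N c u) (star (muVec N c u)) := by
  rw [targetGram, add_sub_cancel_left]

theorem targetGram_sub_diagonal_posSemidef (N : ℕ) {t : ℝ} (ht : 0 ≤ t) (c : ℝ) (u : ℂ) :
    (targetGram N t c u -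
      Matrix.diagonal (fun i : Fin (N + 1) => ((1 - t * cSeq c i : ℝ) : ℂ))).PosSemidef := by
  rw [targetGram_sub_diagonal]
  exact (Matrix.posSemidef_vecMulVec_self_star _).smul (Complex.zero_le_real.mpr ht)

theorem targetGram_posSemidef (N : ℕ) {t c : ℝ} (ht : 0 ≤ t) (u : ℂ)
    (hc : ∀ i, t * cSeq c i ≤ 1) : (targetGram N t c u).PosSemidef :=
  (Matrix.PosSemidef.diagonal fun _ => Complex.zero_le_real.mpr (sub_nonneg.mpr (hc _))).add
    ((Matrix.posSemidef_vecMulVec_self_star _).smul (Complex.zero_le_real.mpr ht))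

/-- The term `t |μ_i|² = t c_i` restores what the diagonal part lacks, so the target vectors are
normalized. -/
theorem targetGram_diag {N : ℕ} {t c : ℝ} {u : ℂ} (hc : 0 < c) (hu : ‖u‖ = 1) (i : Fin (N + 1)) :
    targetGram N t c u i i = 1 := by
  have h1 : ((Real.sqrt (cSeq c i) : ℝ) : ℂ) * (Real.sqrt (cSeq c i) : ℝ) = (cSeq c i : ℝ) := by
    rw [← Complex.ofReal_mul, Real.mul_self_sqrt (cSeq_pos hc i).le]
  have h2 : u ^ (i : ℕ) * (starRingEnd ℂ u) ^ (i : ℕ) = 1 := by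
    rw [← mul_pow, Complex.mul_conj', hu]; simp
  simp only [targetGram, muVec, Matrix.add_apply, Matrix.smul_apply, Matrix.vecMulVec_apply,
    Matrix.diagonal_apply_eq, Pi.star_apply, star_mul', star_pow, RCLike.star_def,
    Complex.conj_ofReal, smul_eq_mul]
  push_cast
  linear_combination (t : ℂ) * (u ^ (i : ℕ) * (starRingEnd ℂ u) ^ (i : ℕ)) * h1
    + (t : ℂ) * (cSeq c i : ℂ) * h2

/-- Since `c_i c_{i+1} = 1`, the entry does not depend on `i`; this lets the same input `φ` serve in
every round. -/
theorem targetGram_succ_castSucc {N : ℕ} {t c : ℝ} {u : ℂ} (hc : 0 < c) (hu : ‖u‖ = 1)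
    (i : Fin N) : targetGram N t c u i.succ i.castSucc = t * u := by
  have h1 : ((Real.sqrt (cSeq c (i + 1)) : ℝ) : ℂ) * (Real.sqrt (cSeq c i) : ℝ) = 1 := by
    rw [← Complex.ofReal_mul, ← Real.sqrt_mul (cSeq_pos hc _).le, mul_comm, cSeq_mul_cSeq_succ hc]
    simp
  have h2 : u ^ (i : ℕ) * (starRingEnd ℂ u) ^ (i : ℕ) = 1 := by
    rw [← mul_pow, Complex.mul_conj', hu]; simp
  have hne : i.succ ≠ i.castSucc := (Fin.castSucc_lt_succ (i := i)).ne'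
  simp only [targetGram, muVec, Matrix.add_apply, Matrix.smul_apply, Matrix.vecMulVec_apply,
    Matrix.diagonal_apply_ne _ hne, Pi.star_apply, star_mul', star_pow, RCLike.star_def,
    Complex.conj_ofReal, Fin.val_succ, Fin.val_castSucc, smul_eq_mul, zero_add, pow_succ]
  linear_combination (t : ℂ) * u * (u ^ (i : ℕ) * (starRingEnd ℂ u) ^ (i : ℕ)) * h1
    + (t : ℂ) * u * h2

/-- Vectors with a prescribed Gram matrix in `ℂ^ι ⊗ ℂ^n`. -/
theorem exists_vectors_of_gram [Nonempty ι] {n : ℕ} {G : Matrix (Fin n) (Fin n) ℂ}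
    (hG : G.PosSemidef) :
    ∃ ξ : Fin n → ι × Fin n → ℂ, ∀ i j, star (ξ i) ⬝ᵥ ξ j = G i j := by
  obtain ⟨R, rfl⟩ := exists_eq_conjTranspose_mul_self hG
  obtain ⟨x₀⟩ := ‹Nonempty ι›
  refine ⟨fun i x => if x.1 = x₀ then R x.2 i else 0, fun i j => ?_⟩
  simp only [dotProduct, Fintype.sum_prod_type, Pi.star_apply, Matrix.mul_apply,
    Matrix.conjTranspose_apply]
  rw [Finset.sum_eq_single x₀ (fun y _ hy => by simp [hy]) (by simp)]
  simp

theorem exists_unitary_pair_mulVec_eq {m : Type*} [Fintype m] [DecidableEq m] {v₀ v₁ w₀ w₁ : m → ℂ}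
    (h0 : star v₀ ⬝ᵥ v₀ = star w₀ ⬝ᵥ w₀) (h1 : star v₁ ⬝ᵥ v₁ = star w₁ ⬝ᵥ w₁)
    (h : star v₁ ⬝ᵥ v₀ = star w₁ ⬝ᵥ w₀) :
    ∃ W : Matrix.unitaryGroup m ℂ,
      (W : Matrix m m ℂ).mulVec v₀ = w₀ ∧ (W : Matrix m m ℂ).mulVec v₁ = w₁ := by
  have h' : star v₀ ⬝ᵥ v₁ = star w₀ ⬝ᵥ w₁ := by
    rw [Matrix.star_dotProduct, h, ← Matrix.star_dotProduct]
  obtain ⟨W, hW⟩ := exists_unitary_mul_eq (Matrix.of fun x j => ![v₀, v₁] j x)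
    (Matrix.of fun x j => ![w₀, w₁] j x) (by
      ext i j
      change star (![v₀, v₁] i) ⬝ᵥ ![v₀, v₁] j = star (![w₀, w₁] i) ⬝ᵥ ![w₀, w₁] j
      fin_cases i <;> fin_cases j <;> simp [*])
  exact ⟨W, funext fun x => congrFun (congrFun hW x) 0, funext fun x => congrFun (congrFun hW x) 1⟩

/-- A unitary strategy whose states before the measurement have the target Gram matrix. -/
theorem exists_unitaryStrategy_gram_eq [Nonempty ι] (U₀ U₁ : Matrix.unitaryGroup ι ℂ) {N : ℕ}
    (hN : 1 ≤ N) {t c : ℝ} (ht : 0 ≤ t) (hc : 0 < c) (htc : ∀ i, t * cSeq c i ≤ 1) {φ : ι → ℂ}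
    {u : ℂ} (hφ : star φ ⬝ᵥ φ = 1) (hu : ‖u‖ = 1) (h : overlap U₀ U₁ φ = (t : ℂ) * u) :
    ∃ S : UnitaryStrategy ι (N + 1), S.gram U₀ U₁ N = targetGram N t c u := by
  obtain ⟨ξ, hξ⟩ := exists_vectors_of_gram (ι := ι) (targetGram_posSemidef N ht u htc)
  let tensor : (ι → ℂ) → ι × Fin (N + 1) → ℂ := fun v x => if x.2 = 0 then v x.1 else 0
  have htensor : ∀ v w, star (tensor v) ⬝ᵥ tensor w = star v ⬝ᵥ w := by
    intro v w
    simp only [dotProduct, Fintype.sum_prod_type, Pi.star_apply, tensor]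
    refine Finset.sum_congr rfl fun i _ => ?_
    rw [Finset.sum_eq_single 0 (fun y _ hy => by simp [hy]) (by simp)]
    simp
  have hext : ∀ (U : Matrix.unitaryGroup ι ℂ) v,
      (extendUnitary (N + 1) U : Matrix (ι × Fin (N + 1)) (ι × Fin (N + 1)) ℂ).mulVec (tensor v)
        = tensor ((U : Matrix ι ι ℂ).mulVec v) := by
    intro U v
    ext x
    simp only [extendUnitary, Matrix.mulVec, dotProduct, Fintype.sum_prod_type,
      Matrix.kroneckerMap_apply, Matrix.one_apply, tensor, mul_ite, mul_one, mul_zero, ite_mul,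
      zero_mul]
    split_ifs <;> simp [*]
  set V₀ := extendUnitary (N + 1) U₀ with hV₀
  set V₁ := extendUnitary (N + 1) U₁ with hV₁
  -- `φ'` is the vector that `U₁` sends where `U₀` sends `φ`. Its overlap with `φ` is `t u`, as for
  -- neighbouring target vectors.
  set φ' : ι → ℂ := ((star U₁ * U₀ : Matrix.unitaryGroup ι ℂ) : Matrix ι ι ℂ).mulVec φ with hφ'
  have hVφ : (V₁ : Matrix (ι × Fin (N + 1)) (ι × Fin (N + 1)) ℂ).mulVec (tensor φ')
      = (V₀ : Matrix (ι × Fin (N + 1)) (ι × Fin (N + 1)) ℂ).mulVec (tensor φ) := by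
    rw [hext, hext, hφ', coe_unitary_mul_mulVec, ← mul_assoc, Unitary.mul_star_self, one_mul]
  have hφφ' : star φ' ⬝ᵥ φ = t * u := by
    rw [← h, hφ', Matrix.star_mulVec, ← Matrix.dotProduct_mulVec, overlap]
    simp [Matrix.star_eq_conjTranspose]
  let η : ℕ → ι × Fin (N + 1) → ℂ := fun n => ξ (Fin.ofNat (N + 1) n)
  have hW : ∀ n, ∃ W : Matrix.unitaryGroup (ι × Fin (N + 1)) ℂ, n < N →
      (W : Matrix (ι × Fin (N + 1)) (ι × Fin (N + 1)) ℂ).mulVec (η n) = tensor φ ∧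
      (W : Matrix (ι × Fin (N + 1)) (ι × Fin (N + 1)) ℂ).mulVec (η (n + 1)) = tensor φ' := by
    intro n
    by_cases hn : n < N
    · have e1 : Fin.ofNat (N + 1) n = (⟨n, hn⟩ : Fin N).castSucc :=
        Fin.ext (Nat.mod_eq_of_lt (by omega))
      have e2 : Fin.ofNat (N + 1) (n + 1) = (⟨n, hn⟩ : Fin N).succ :=
        Fin.ext (Nat.mod_eq_of_lt (by omega))
      obtain ⟨W, hW⟩ := exists_unitary_pair_mulVec_eq (v₀ := η n) (v₁ := η (n + 1))
        (w₀ := tensor φ) (w₁ := tensor φ')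
        (by rw [hξ, targetGram_diag hc hu, htensor, hφ])
        (by rw [hξ, targetGram_diag hc hu, htensor, hφ', star_unitary_mulVec_dotProduct, hφ])
        (by rw [hξ, e1, e2, targetGram_succ_castSucc hc hu, htensor, hφφ'])
      exact ⟨W, fun _ => hW⟩
    · exact ⟨1, fun hn' => absurd hn' hn⟩
  choose W hW using hW
  -- Each gate undoes the previous round, `V₁ * W n`, and then places the next neighbouring pair at
  -- `φ`, `φ'`.
  let S : UnitaryStrategy ι (N + 1) :=
    ⟨tensor φ, (htensor φ φ).trans hφ, fun n => W (n + 1) * (V₁ * W n)⁻¹⟩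
  -- Up to a unitary independent of `k`, the state is target vector number `min k (n + 1)`. After
  -- the change, `V₁` leaves the label alone; before it, `V₀` acts on `φ` as `V₁` does on `φ'`,
  -- which raises the label by one.
  have hpsi : ∀ k n, n < N → S.psi U₀ U₁ k n
      = ((V₁ * W n : Matrix.unitaryGroup (ι × Fin (N + 1)) ℂ) :
          Matrix (ι × Fin (N + 1)) (ι × Fin (N + 1)) ℂ).mulVec
        (η (min k (n + 1))) := by
    have hstep : ∀ k n, n < N →
        ((extendUnitary (N + 1) (if k < n + 1 then U₁ else U₀) :
          Matrix.unitaryGroup (ι × Fin (N + 1)) ℂ) :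
            Matrix (ι × Fin (N + 1)) (ι × Fin (N + 1)) ℂ).mulVec
          ((W n : Matrix (ι × Fin (N + 1)) (ι × Fin (N + 1)) ℂ).mulVec (η (min k n)))
        = ((V₁ * W n : Matrix.unitaryGroup (ι × Fin (N + 1)) ℂ) :
          Matrix (ι × Fin (N + 1)) (ι × Fin (N + 1)) ℂ).mulVec
          (η (min k (n + 1))) := by
      intro k n hn
      rw [← coe_unitary_mul_mulVec]
      by_cases hk : k < n + 1
      · rw [if_pos hk, min_eq_left (by omega), min_eq_left (by omega)]
      · rw [if_neg hk, min_eq_right (by omega), min_eq_right (by omega), (hW n hn).1, (hW n hn).2,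
          hVφ]
    intro k n
    induction n with
    | zero =>
      intro hn
      rw [← hstep k 0 hn, Nat.min_zero, (hW 0 hn).1]
      rfl
    | succ n ih =>
      intro hn
      rw [← hstep k (n + 1) hn, UnitaryStrategy.psi, ih (by omega), coe_unitary_mul_mulVec,
        show S.gate n = W (n + 1) * (V₁ * W n)⁻¹ from rfl, inv_mul_cancel_right]
      rfl
  refine ⟨S, ?_⟩
  ext i j
  have hη : ∀ i : Fin (N + 1), η (min i (N - 1 + 1)) = ξ i := by
    intro i
    have : min (i : ℕ) (N - 1 + 1) = i := min_eq_left (by omega)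
    rw [this]
    exact congrArg ξ (Fin.ext (Nat.mod_eq_of_lt i.isLt))
  rw [UnitaryStrategy.gram, Matrix.of_apply, hpsi _ _ (by omega), hpsi _ _ (by omega),
    star_unitary_mulVec_dotProduct, hη, hη, hξ]

end Strategy

/-! ### Optimal values -/

section Optimal

variable {ι : Type*} [Fintype ι] [DecidableEq ι] [Nonempty ι] (U₀ U₁ : Matrix.unitaryGroup ι ℂ)

theorem minOverlap_le_one : minOverlap U₀ U₁ ≤ 1 := by
  obtain ⟨i⟩ := ‹Nonempty ι›
  refine ((isLeast_overlapValues U₀ U₁).2 ⟨Pi.single i 1, by simp, rfl⟩).trans ?_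
  have h : overlap U₀ U₁ (Pi.single i 1)
      = ((star U₀ * U₁ : Matrix.unitaryGroup ι ℂ) : Matrix ι ι ℂ) i i := by
    simp [overlap, Matrix.star_eq_conjTranspose]
  rw [h]
  exact entry_norm_bound_of_unitary (star U₀ * U₁).2 i i

theorem mem_pairRegion_iff {p q : ℝ} :
    (p, q) ∈ pairRegion (unitaryChannel U₀) (unitaryChannel U₁) ↔
      (0 ≤ p ∧ p ≤ 1) ∧ (0 ≤ q ∧ q ≤ 1) ∧ minOverlap U₀ U₁ ^ 2 ≤ (1 - p) * (1 - q) := by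
  constructor
  · rintro ⟨T, hT, rfl, rfl⟩
    refine ⟨⟨T.prob_nonneg _ _, T.prob_le_one _ _⟩, ⟨T.prob_nonneg _ _, T.prob_le_one _ _⟩, ?_⟩
    exact T.minOverlap_sq_le U₀ U₁ (s := 0) one_pos rfl rfl (fun i hi hi0 => by omega)
      (by simp) (hT 1 0 (by simp)) (hT 0 1 (by simp))
  · rintro ⟨⟨hp0, hp1⟩, ⟨hq0, hq1⟩, h⟩
    obtain ⟨φ, hφ, hφt⟩ := (isLeast_overlapValues U₀ U₁).1
    exact mem_pairRegion_of_sq_le U₀ U₁ hφ hp0 hp1 hq0 hq1 (hφt ▸ h)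

theorem minOverlap_sq_le_one : minOverlap U₀ U₁ ^ 2 ≤ 1 :=
  pow_le_one₀ (minOverlap_nonneg U₀ U₁) (minOverlap_le_one U₀ U₁)

theorem isGreatest_identifiable₀ :
    IsGreatest (identifiable₀ (unitaryChannel U₀) (unitaryChannel U₁))
      (1 - minOverlap U₀ U₁ ^ 2) := by
  have h1 := minOverlap_sq_le_one U₀ U₁
  constructor
  · exact ⟨0, (mem_pairRegion_iff U₀ U₁).mpr
      ⟨⟨by linarith, by linarith [sq_nonneg (minOverlap U₀ U₁)]⟩, ⟨le_rfl, zero_le_one⟩,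
        by linarith⟩⟩
  · rintro p ⟨q, hpq⟩
    obtain ⟨⟨hp0, hp1⟩, ⟨hq0, hq1⟩, h⟩ := (mem_pairRegion_iff U₀ U₁).mp hpq
    nlinarith

theorem pbar_eq : pbar (unitaryChannel U₀) (unitaryChannel U₁) = 1 - minOverlap U₀ U₁ ^ 2 :=
  (isGreatest_identifiable₀ U₀ U₁).csSup_eq

theorem isGreatest_identifiable₁ {p : ℝ} (hp : p ∈ Set.Icc 0 (1 - minOverlap U₀ U₁ ^ 2)) :
    IsGreatest (identifiable₁ (unitaryChannel U₀) (unitaryChannel U₁) p)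
      (1 - minOverlap U₀ U₁ ^ 2 / (1 - p)) := by
  have ht2 := sq_nonneg (minOverlap U₀ U₁)
  obtain ⟨hp0, hp1⟩ := hp
  have hp' : 0 ≤ 1 - p := by linarith
  constructor
  · refine (mem_pairRegion_iff U₀ U₁).mpr ⟨⟨hp0, by linarith⟩, ⟨?_, ?_⟩, ?_⟩
    · exact sub_nonneg.mpr (div_le_one_of_le₀ (by linarith) hp')
    · exact sub_le_self _ (div_nonneg ht2 hp')
    · rw [sub_sub_cancel]
      -- The case `p = 1` forces `t = 0`; division by zero then yields the correct value `f 1 = 1`.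
      rcases hp'.eq_or_lt with h0 | h0
      · rw [← h0, zero_mul]
        linarith
      · rw [mul_div_cancel₀ _ h0.ne']
  · intro q hq
    obtain ⟨-, ⟨-, hq1⟩, h⟩ := (mem_pairRegion_iff U₀ U₁).mp hq
    have : minOverlap U₀ U₁ ^ 2 / (1 - p) ≤ 1 - q :=
      div_le_of_le_mul₀ hp' (sub_nonneg.mpr hq1) (h.trans_eq (mul_comm _ _))
    linarith

theorem tradeoff_eq {p : ℝ} (hp : p ∈ Set.Icc 0 (1 - minOverlap U₀ U₁ ^ 2)) :
    tradeoff (unitaryChannel U₀) (unitaryChannel U₁) p = 1 - minOverlap U₀ U₁ ^ 2 / (1 - p) :=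
  (isGreatest_identifiable₁ U₀ U₁ hp).csSup_eq

/-- The average success probability with success probabilities `1 - t c_i`. -/
noncomputable def optimalAverage (N : ℕ) : ℝ :=
  (∑ i : Fin (N + 1), (1 - minOverlap U₀ U₁ * cSeq (cParam (minOverlap U₀ U₁) N) i)) / (N + 1)

theorem isGreatest_boundValues {N : ℕ} (hN : 1 ≤ N) :
    IsGreatest (boundValues (unitaryChannel U₀) (unitaryChannel U₁) N) (optimalAverage U₀ U₁ N) := by
  set t := minOverlap U₀ U₁ with ht
  have ht0 : 0 ≤ t := minOverlap_nonneg U₀ U₁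
  have ht1 : t ≤ 1 := minOverlap_le_one U₀ U₁
  set c := cParam t N with hc
  have hcpos : 0 < c := cParam_pos t hN
  have htc : t ≤ c := le_cParam ht1 N
  have hc1 : c ≤ 1 := cParam_le_one ht1 N
  have hmem : ∀ i, 1 - t * cSeq c i ∈ Set.Icc 0 (1 - t ^ 2) := fun i =>
    ⟨sub_nonneg.mpr (mul_cSeq_le_one ht0 htc hcpos hc1 i),
      sub_le_sub_left (sq_le_mul_cSeq ht0 htc hcpos hc1 i) 1⟩
  constructor
  · refine ⟨fun i => 1 - t * cSeq c i, ?_, fun i => ⟨(hmem _).1, ?_⟩, rfl⟩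
    · rw [pbar_eq]
      exact hmem _
    · rw [tradeoff_eq U₀ U₁ (hmem _), ← ht, sub_sub_cancel]
      refine sub_le_sub_left (div_le_of_le_mul₀ (mul_nonneg ht0 (cSeq_pos hcpos _).le)
        (mul_nonneg ht0 (cSeq_pos hcpos _).le) (le_of_eq ?_)) 1
      have h := cSeq_mul_cSeq_succ hcpos i
      rw [Fin.val_succ, Fin.val_castSucc]
      linear_combination (-t ^ 2) * h
  · rintro P ⟨p, hlast, hp, rfl⟩
    -- `f` maps `[0, p̄]` into itself, so the formula for `f` applies along the whole chain,
    -- descending from `p_N`.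
    have hle : ∀ {q : ℝ}, q ∈ Set.Icc 0 (1 - t ^ 2) → 1 - t ^ 2 / (1 - q) ≤ 1 - t ^ 2 := by
      intro q hq
      refine sub_le_sub_left ?_ 1
      rcases (show 0 ≤ 1 - q by nlinarith [hq.2]).eq_or_lt with h0 | h0
      · have : t ^ 2 = 0 := by nlinarith [hq.2, sq_nonneg t]
        simp [this]
      · rw [le_div_iff₀ h0]
        nlinarith [hq.1, sq_nonneg t]
    have hall : ∀ i, p i ∈ Set.Icc 0 (1 - t ^ 2) := by
      intro i
      induction i using Fin.reverseInduction with
      | last => rwa [pbar_eq] at hlast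
      | cast i ih =>
        have h := hp i
        rw [tradeoff_eq U₀ U₁ ih] at h
        exact ⟨h.1, h.2.trans (hle ih)⟩
    refine average_le_of_sq_le hN p (fun i => (hall i).1)
      (fun i => (hall i).2.trans (sub_le_self _ (sq_nonneg t))) fun i => ?_
    have h := (hp i).2
    rw [tradeoff_eq U₀ U₁ (hall _), ← ht] at h
    have hq := (hall i.succ).2
    rcases (show 0 ≤ 1 - p i.succ by nlinarith).eq_or_lt with h0 | h0
    · rw [← h0, mul_zero]
      linarith
    · exact (div_le_iff₀ h0).mp (by linarith)

theorem averageSuccess_le {N : ℕ} (hN : 1 ≤ N) (T : Tester ι ι N (Option (Fin (N + 1))))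
    (hT : T.IsUnambiguous (changeProcess (unitaryChannel U₀) (unitaryChannel U₁) N)) :
    averageSuccess (unitaryChannel U₀) (unitaryChannel U₁) N T ≤ optimalAverage U₀ U₁ N := by
  refine average_le_of_sq_le hN _ (fun i => T.prob_nonneg _ _) (fun i => T.prob_le_one _ _)
    fun i => ?_
  have hne : i.succ ≠ i.castSucc := (Fin.castSucc_lt_succ (i := i)).ne'
  rw [mul_comm]
  -- Channel number `i + 1` is `Λ₀` for change point `i + 1` and `Λ₁` for change point `i`; hence
  -- the swapped factors.
  refine T.minOverlap_sq_le U₀ U₁ (s := i) i.isLt ?_ ?_ (fun j _ hji => ?_)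
    (by simpa using hne) (hT _ _ hne) (hT _ _ hne.symm)
  · exact if_neg (by simp)
  · exact if_pos (by simp)
  · unfold changeProcess
    congr 1
    simp only [Fin.val_succ, Fin.val_castSucc, eq_iff_iff]
    omega

/-- An optimal unitary strategy with the target Gram matrix. -/
theorem exists_optimal_unitaryStrategy {N : ℕ} (hN : 1 ≤ N) {t c : ℝ}
    (ht : t = minOverlap U₀ U₁) (hc : c = cParam t N) {φ : ι → ℂ} {u : ℂ} (hφ : star φ ⬝ᵥ φ = 1)
    (hu : ‖u‖ = 1) (h : overlap U₀ U₁ φ = (t : ℂ) * u) :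
    ∃ (a : ℕ) (S : UnitaryStrategy ι a) (M : POVM (Option (Fin (N + 1))) (ι × Fin a)),
      S.gram U₀ U₁ N = targetGram N t c u ∧
      (S.toTester N M).IsUnambiguous (changeProcess (unitaryChannel U₀) (unitaryChannel U₁) N) ∧
      (∀ k : Fin (N + 1), (S.toTester N M).success
        (changeProcess (unitaryChannel U₀) (unitaryChannel U₁) N) k = 1 - t * cSeq c k) ∧
      averageSuccess (unitaryChannel U₀) (unitaryChannel U₁) N (S.toTester N M)
        = optimalAverage U₀ U₁ N := by
  have ht0 : 0 ≤ t := ht ▸ minOverlap_nonneg U₀ U₁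
  have ht1 : t ≤ 1 := ht ▸ minOverlap_le_one U₀ U₁
  have hcpos : 0 < c := hc ▸ cParam_pos t hN
  have htc : ∀ i, t * cSeq c i ≤ 1 :=
    mul_cSeq_le_one ht0 (hc ▸ le_cParam ht1 N) hcpos (hc ▸ cParam_le_one ht1 N)
  obtain ⟨S, hS⟩ := exists_unitaryStrategy_gram_eq U₀ U₁ hN ht0 hcpos htc hφ hu h
  have hps := targetGram_sub_diagonal_posSemidef N ht0 c u
  rw [← hS] at hps
  obtain ⟨M, hM⟩ := exists_povm_of_gram_sub_diagonal_posSemidef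
    (fun k : Fin (N + 1) => S.psi U₀ U₁ k (N - 1)) (fun k => 1 - t * cSeq c k)
    (fun k => sub_nonneg.mpr (htc k)) hps
  have hprob : ∀ k j : Fin (N + 1), (S.toTester N M).prob
      (changeProcess (unitaryChannel U₀) (unitaryChannel U₁) N k) (some j)
      = if k = j then 1 - t * cSeq c j else 0 := by
    intro k j
    rw [UnitaryStrategy.prob_toTester, hM]
    split_ifs
    · exact Complex.ofReal_re _
    · exact Complex.zero_re
  have hsucc : ∀ k : Fin (N + 1), (S.toTester N M).success
      (changeProcess (unitaryChannel U₀) (unitaryChannel U₁) N) k = 1 - t * cSeq c k := fun k =>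
    (hprob k k).trans (if_pos rfl)
  refine ⟨N + 1, S, M, hS, fun k j hjk => (hprob k j).trans (if_neg hjk.symm), hsucc, ?_⟩
  rw [averageSuccess, optimalAverage, ← ht, ← hc]
  simp only [hsucc]

theorem isGreatest_achievableValues {N : ℕ} (hN : 1 ≤ N) :
    IsGreatest (achievableValues (unitaryChannel U₀) (unitaryChannel U₁) N)
      (optimalAverage U₀ U₁ N) := by
  constructor
  · obtain ⟨φ, hφ, hφt⟩ := (isLeast_overlapValues U₀ U₁).1
    obtain ⟨u, hu, h⟩ : ∃ u : ℂ, ‖u‖ = 1 ∧ overlap U₀ U₁ φ = (minOverlap U₀ U₁ : ℂ) * u := by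
      -- Taking the phase from the argument avoids dividing by `t`, which may be zero.
      refine ⟨Complex.exp (Complex.arg (overlap U₀ U₁ φ) * Complex.I),
        Complex.norm_exp_ofReal_mul_I _, ?_⟩
      rw [← hφt, Complex.norm_mul_exp_arg_mul_I]
    obtain ⟨a, S, M, -, hun, -, hav⟩ := exists_optimal_unitaryStrategy U₀ U₁ hN rfl rfl hφ hu h
    exact ⟨_, hun, hav⟩
  · rintro P ⟨T, hT, rfl⟩
    exact averageSuccess_le U₀ U₁ hN T hT

end Optimal

end ChangePoint

theorem theorem2 {ι : Type*} [Fintype ι] [DecidableEq ι] [Nonempty ι]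
    (U₀ U₁ : Matrix.unitaryGroup ι ℂ) (N : ℕ) (hN : 1 ≤ N)
    (Λ₀ Λ₁ : ChangePoint.Channel ι ι)
    (hΛ₀ : Λ₀ = ChangePoint.unitaryChannel U₀) (hΛ₁ : Λ₁ = ChangePoint.unitaryChannel U₁)
    (t c : ℝ) (ht : t = ChangePoint.minOverlap U₀ U₁) (hc : c = ChangePoint.cParam t N) :
    -- all the extrema that enter the statement are attained
    IsLeast (ChangePoint.overlapValues U₀ U₁) t ∧
    IsGreatest (ChangePoint.identifiable₀ Λ₀ Λ₁) (ChangePoint.pbar Λ₀ Λ₁) ∧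
    (∀ p ∈ Set.Icc 0 (ChangePoint.pbar Λ₀ Λ₁),
      IsGreatest (ChangePoint.identifiable₁ Λ₀ Λ₁ p) (ChangePoint.tradeoff Λ₀ Λ₁ p)) ∧
    ChangePoint.tradeoff Λ₀ Λ₁ 0 ≤ ChangePoint.pbar Λ₀ Λ₁ ∧
    IsGreatest (ChangePoint.boundValues Λ₀ Λ₁ N) (ChangePoint.upperBound Λ₀ Λ₁ N) ∧
    IsGreatest (ChangePoint.achievableValues Λ₀ Λ₁ N) (ChangePoint.optimalSuccess Λ₀ Λ₁ N) ∧
    -- the maximum equals the upper bound, with its closed form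
    ChangePoint.optimalSuccess Λ₀ Λ₁ N = ChangePoint.upperBound Λ₀ Λ₁ N ∧
    ChangePoint.optimalSuccess Λ₀ Λ₁ N
      = 1 - t * ((((N : ℝ) + 2) * c + (N : ℝ) * c⁻¹) / (2 * ((N : ℝ) + 1))) ∧
    -- an optimal sequential strategy with the stated Gram matrix
    (∀ (φ : ι → ℂ) (u : ℂ), star φ ⬝ᵥ φ = 1 → ‖u‖ = 1 →
      ChangePoint.overlap U₀ U₁ φ = (t : ℂ) * u →
      ∃ (a : ℕ) (S : ChangePoint.UnitaryStrategy ι a)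
        (M : ChangePoint.POVM (Option (Fin (N + 1))) (ι × Fin a)),
        S.gram U₀ U₁ N = ChangePoint.targetGram N t c u ∧
        (S.toTester N M).IsUnambiguous (ChangePoint.changeProcess Λ₀ Λ₁ N) ∧
        (∀ k : Fin (N + 1),
          (S.toTester N M).success (ChangePoint.changeProcess Λ₀ Λ₁ N) k
            = 1 - t * ChangePoint.cSeq c k) ∧
        ChangePoint.averageSuccess Λ₀ Λ₁ N (S.toTester N M)
          = ChangePoint.optimalSuccess Λ₀ Λ₁ N) := by
  subst hΛ₀ hΛ₁
  have hbound := ChangePoint.isGreatest_boundValues U₀ U₁ hN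
  have hach := ChangePoint.isGreatest_achievableValues U₀ U₁ hN
  have hb : ChangePoint.upperBound (ChangePoint.unitaryChannel U₀) (ChangePoint.unitaryChannel U₁) N
      = ChangePoint.optimalAverage U₀ U₁ N := hbound.csSup_eq
  have ho : ChangePoint.optimalSuccess (ChangePoint.unitaryChannel U₀)
      (ChangePoint.unitaryChannel U₁) N = ChangePoint.optimalAverage U₀ U₁ N := hach.csSup_eq
  have h0 : (0 : ℝ) ∈ Set.Icc 0 (1 - ChangePoint.minOverlap U₀ U₁ ^ 2) :=
    ⟨le_rfl, sub_nonneg.mpr (ChangePoint.minOverlap_sq_le_one U₀ U₁)⟩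
  refine ⟨ht ▸ ChangePoint.isLeast_overlapValues U₀ U₁, ?_, fun p hp => ?_, ?_, hb ▸ hbound,
    ho ▸ hach, ho.trans hb.symm, ?_, fun φ u hφ hu h => ?_⟩
  · rw [ChangePoint.pbar_eq]
    exact ChangePoint.isGreatest_identifiable₀ U₀ U₁
  · rw [ChangePoint.pbar_eq] at hp
    rw [ChangePoint.tradeoff_eq U₀ U₁ hp]
    exact ChangePoint.isGreatest_identifiable₁ U₀ U₁ hp
  · rw [ChangePoint.pbar_eq, ChangePoint.tradeoff_eq U₀ U₁ h0, sub_zero, div_one]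
  · rw [ho, hc, ht]
    exact ChangePoint.average_cSeq _ N
  · rw [ho]
    exact ChangePoint.exists_optimal_unitaryStrategy U₀ U₁ hN ht hc hφ hu h
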